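/- A $k$-player one-round game $G=(\mu,V)$ consists of finite question alphabets $\mathcal X^1,\dots,\mathcal X^k$, finite answer alphabets $\mathcal A^1,\dots,\mathcal A^k$, a probability distribution $\mu$ on $\mathcal X=\mathcal X^1\times\cdots\times\mathcal X^k$ and a predicate $V:\mathcal X\times\mathcal A\to\{0,1\}$, where $\mathcal A=\mathcal A^1\times\cdots\times\mathcal A^k$. A strategy is a tuple of functions $f^t:\mathcal X^t\to\mathcal A^t$, and the value $\mathrm{val}(G)$ is the maximum over all strategies of $\Pr_{x\sim\mu}[V(x,(f^1(x^1),\dots,f^k(x^k)))=1]$. In the $n$-fold parallel repetition $G^{\otimes n}$, $n$ question tuples $x_1,\dots,x_n$ are drawn independently from $\mu$, player $t$ receives $(x^t_1,\dots,x^t_n)$ and answers with $(a^t_1,\dots,a^t_n)$, and the players win if $V(x_i,a_i)=1$ for every $i$. Let $X\sim\mu$ and write $x^{-t}$ for the questions in $x$ to all the players but $t$. The $(k-1)$-connection graph $H_G$ is the weighted graph on $\mathcal X$ with the weights $$\rho(x,x')=\begin{cases}\frac1k\,\mathsf P_X(x)\sum_{t=1}^k \mathsf P_{X^t|X^{-t}=x^{-t}}(x^t)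 & \text{if } x=x',\\[2pt] \frac1k\,\mathsf P_{X^{-t}}(x^{-t})\,\mathsf P_{X^t|X^{-t}=x^{-t}}(x^t)\,\mathsf P_{X^t|X^{-t}=x^{-t}}(x'^t) & \text{if } x^{-t}=x'^{-t},\ x^t\ne x'^t \text{ for some } t,\\[2pt] 0&\text{otherwise}\end{cases}$$ (a conditional probability given an event of probability $0$ is read as $0$). Put $\rho(x)=\sum_{x'}\rho(x,x')$. The normalized Laplacian of $H_G$, on the vertices with $\rho(x)\neq 0$, is the symmetric matrix with the entries $1-\rho(x,x)/\rho(x)$ on the diagonal and $-\rho(x,x')/\sqrt{\rho(x)\rho(x')}$ off the diagonal. For $\lambda\in(0,1)$, $H_G$ is a $\lambda$-expander if the second-smallest eigenvalue of this matrix, counted with multiplicity, is at least $\lambda$ (a graph with a single vertex of non-zero weight counts as a $\lambda$-expander). **Theorem.** There is a universal constant $c>0$ such that the following holds. Let $\varepsilon,\lambda\in(0,1)$ and let $G$ be a $k$-player game with $|\mathcal A|\ge 2$ and $\mathrm{val}(G)\le 1-\varepsilon$. If $H_G$ is a $\lambda$-expander, then for all $n\ge\dfrac{\log(4/\varepsilon)}{\varepsilon^5\lambda^2}$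 (natural logarithm), $$\mathrm{val}(G^{\otimes n})\le\exp\left(-\frac{c\,\varepsilon^5\lambda^2 n}{\log|\mathcal A|}\right).$$ -/

import Mathlib

/-- A one-round `k`-player game: player `t` has the finite question alphabet `X t` and the finite
answer alphabet `A t`; `μ` is the distribution of the question tuple and `V x a` says whether the
referee accepts the answer tuple `a` to the question tuple `x`. -/
structure Game (k : ℕ) (X : Fin k → Type*) (A : Fin k → Type*) [∀ t, Fintype (X t)] where
  /-- the probability of a question tuple -/
  μ : (∀ t, X t) → ℝ
  μ_nonneg : ∀ x, 0 ≤ μ x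
  μ_sum : ∑ x, μ x = 1
  /-- the predicate of the referee -/
  V : (∀ t, X t) → (∀ t, A t) → Bool

/-- A weighted (undirected) graph on the vertex set `W`, loops allowed. -/
structure WeightedGraph (W : Type*) where
  weight : W → W → ℝ
  weight_nonneg : ∀ u v, 0 ≤ weight u v
  weight_symm : ∀ u v, weight u v = weight v u

namespace WeightedGraph

noncomputable section

variable {W : Type*} [Fintype W]

/-- The weight `ρ(u) = ∑ v, ρ(u, v)` of a vertex. -/
def degree (H : WeightedGraph W) (u : W) : ℝ := ∑ v, H.weight u v

open Classical in
/-- The normalized Laplacian, indexed by all the vertices. -/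
def normalizedLaplacian (H : WeightedGraph W) : Matrix W W ℝ := fun u v =>
  if u = v ∧ H.degree v ≠ 0 then 1 - H.weight u v / H.degree v
  else if H.degree u ≠ 0 ∧ H.degree v ≠ 0 then
    -(H.weight u v / Real.sqrt (H.degree u * H.degree v))
  else 0

/-- The vertices of non-zero weight. -/
abbrev Support (H : WeightedGraph W) : Type _ := {v : W // H.degree v ≠ 0}

open Classical in
instance (H : WeightedGraph W) : Fintype H.Support := Subtype.fintype _

/-- The normalized Laplacian, restricted to the vertices of non-zero weight. -/
def supportLaplacian (H : WeightedGraph W) : Matrix H.Support H.Support ℝ :=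
  H.normalizedLaplacian.submatrix Subtype.val Subtype.val

theorem normalizedLaplacian_isHermitian (H : WeightedGraph W) :
    H.normalizedLaplacian.IsHermitian := by
  ext u v
  rw [Matrix.conjTranspose_apply, star_trivial]
  by_cases h : u = v
  · subst h; rfl
  · simp only [normalizedLaplacian, h, Ne.symm h, false_and, if_false, H.weight_symm v u,
      mul_comm (H.degree v), and_comm (a := H.degree v ≠ 0)]

theorem supportLaplacian_isHermitian (H : WeightedGraph W) :
    H.supportLaplacian.IsHermitian :=
  H.normalizedLaplacian_isHermitian.submatrix _

open Classical in
/-- `λ(H)`, the second-smallest eigenvalue (counted with multiplicity) of the normalized Laplacian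
on the vertices of non-zero weight; it is `⊤` when there are fewer than two such vertices.
`Matrix.IsHermitian.eigenvalues₀` lists the eigenvalues in decreasing order. -/
def secondEigenvalue (H : WeightedGraph W) : EReal :=
  if h : 2 ≤ Fintype.card H.Support then
    ((H.supportLaplacian_isHermitian.eigenvalues₀
      ⟨Fintype.card H.Support - 2, by omega⟩ : ℝ) : EReal)
  else ⊤

/-- `H` is an `l`-expander. -/
def IsExpander (H : WeightedGraph W) (l : ℝ) : Prop := (l : EReal) ≤ H.secondEigenvalue

end

end WeightedGraph

namespace Game

noncomputable section

variable {k : ℕ} {X : Fin k → Type*} {A : Fin k → Type*} [∀ t, Fintype (X t)]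

/-- The probability of winning with the strategy `f`, in which player `t` answers the question `q`
by `f t q`. -/
def winProb (G : Game k X A) (f : ∀ t, X t → A t) : ℝ :=
  ∑ x, if G.V x (fun t => f t (x t)) = true then G.μ x else 0

/-- The value of a game: the maximal winning probability over all strategies. -/
def val (G : Game k X A) : ℝ := ⨆ f : ∀ t, X t → A t, G.winProb f

/-- The `n`-fold parallel repetition: `n` independent question tuples are drawn from `μ`, player `t`
gets the `t`-th question of all of them, and the players win if they win in every coordinate. -/
def parallel (G : Game k X A) (n : ℕ) :
    Game k (fun t => Fin n → X t) (fun t => Fin n → A t) where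
  μ x := ∏ i, G.μ (fun t => x t i)
  μ_nonneg x := Finset.prod_nonneg fun i _ => G.μ_nonneg _
  μ_sum := by
    have h := Equiv.sum_comp (Equiv.piComm fun (t : Fin k) (_ : Fin n) => X t)
      (fun y : Fin n → ∀ t, X t => ∏ i, G.μ (y i))
    rw [← Fintype.prod_sum (fun (_ : Fin n) (y : ∀ t, X t) => G.μ y)] at h
    exact h.trans (by simp [G.μ_sum])
  V x a := decide (∀ i, G.V (fun t => x t i) (fun t => a t i) = true)

/-- `P_{X^{-t}}(x^{-t})`, the probability that the players other than `t` get the questions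
in `x`. -/
def probOthers (G : Game k X A) (t : Fin k) (x : ∀ t, X t) : ℝ :=
  ∑ q : X t, G.μ (Function.update x t q)

/-- `P_{X^t | x^{-t}}(x^t)`, the conditional probability that player `t` gets the question `x t`
given that the other players get theirs (`0` if the condition has probability `0`). -/
def condProb (G : Game k X A) (t : Fin k) (x : ∀ t, X t) : ℝ :=
  G.μ x / G.probOthers t x

open Classical in
/-- The weight function `ρ` of the `(k-1)`-connection graph. For `x ≠ x'` the sum has at most one
term, and it has none if `x` and `x'` differ in more than one coordinate. -/
def connectionWeight (G : Game k X A) (x x' : ∀ t, X t) : ℝ :=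
  if x = x' then (1 / (k : ℝ)) * (G.μ x * ∑ t, G.condProb t x)
  else ∑ t with (∀ s, s ≠ t → x s = x' s) ∧ x t ≠ x' t,
    (1 / (k : ℝ)) * (G.probOthers t x * G.condProb t x * G.condProb t x')

theorem probOthers_nonneg (G : Game k X A) (t : Fin k) (x : ∀ t, X t) : 0 ≤ G.probOthers t x :=
  Finset.sum_nonneg fun _ _ => G.μ_nonneg _

theorem condProb_nonneg (G : Game k X A) (t : Fin k) (x : ∀ t, X t) : 0 ≤ G.condProb t x :=
  div_nonneg (G.μ_nonneg _) (G.probOthers_nonneg t x)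

theorem probOthers_congr (G : Game k X A) (t : Fin k) {x x' : ∀ t, X t}
    (h : ∀ s, s ≠ t → x s = x' s) : G.probOthers t x = G.probOthers t x' := by
  refine Finset.sum_congr rfl fun q _ => congrArg G.μ (funext fun s => ?_)
  by_cases hs : s = t
  · subst hs; simp
  · simp [hs, h s hs]

theorem connectionWeight_nonneg (G : Game k X A) (x x' : ∀ t, X t) :
    0 ≤ G.connectionWeight x x' := by
  unfold connectionWeight
  split_ifs
  · exact mul_nonneg (by positivity)
      (mul_nonneg (G.μ_nonneg x) (Finset.sum_nonneg fun t _ => G.condProb_nonneg t x))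
  · exact Finset.sum_nonneg fun t _ => mul_nonneg (by positivity)
      (mul_nonneg (mul_nonneg (G.probOthers_nonneg t x) (G.condProb_nonneg t x))
        (G.condProb_nonneg t x'))

open Classical in
theorem connectionWeight_symm (G : Game k X A) (x x' : ∀ t, X t) :
    G.connectionWeight x x' = G.connectionWeight x' x := by
  unfold connectionWeight
  by_cases h : x = x'
  · subst h; rfl
  · rw [if_neg h, if_neg (Ne.symm h)]
    refine Finset.sum_congr ?_ fun t ht => ?_
    · ext t
      simp only [Finset.mem_filter, Finset.mem_univ, true_and, ne_eq, eq_comm]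
    · rw [Finset.mem_filter] at ht
      rw [G.probOthers_congr t fun s hs => (ht.2.1 s hs).symm]
      ring

/-- The `(k-1)`-connection graph `H_G`. -/
def connectionGraph (G : Game k X A) : WeightedGraph (∀ t, X t) where
  weight := G.connectionWeight
  weight_nonneg := G.connectionWeight_nonneg
  weight_symm := G.connectionWeight_symm

end

end Game

/-!
Fix a strategy for the repeated game and a set `C` of coordinates. It suffices to show that, unless
winning on `C` is already exponentially unlikely, there is a coordinate `i ∉ C` which is lost with
probability at least `ε / 2` conditionally on winning on `C` (`Game.exists_winOn_insert_le`);
iterating this about `ε ^ 2 * l * n / log |A|` times gives the theorem, even with the exponent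
`ε ^ 3 * l * n / log |A|`.

For every coordinate `j ∉ C` choose a player `τ j`, and make public all the questions in the
coordinates of `C`, the answers to them, and in every coordinate `j ∉ C` the questions of the
players other than `τ j`. Given the public information, the questions of the different players are
independent. For the formalization, the public questions are those of a tuple `z j`, from which the
actual tuple `x j` arises by resampling the question of player `τ j`: this leaves the law of `x j`
unchanged, and reveals about it just what should be public.

* *Little information.* The answers on `C` take at most `|A| ^ |C|` values, so conditioning on them
  and on winning on `C` costs a relative entropy of `log (|A| ^ |C| / Pr[win on C])`. It bounds the
  sum over `i` of the amounts, in squared Hellinger distance, by which the law of `x i` given the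
  public information is moved (`sum_sq_sqrt_condExpAt_sub_le`, `Game.sum_hellingerAt_le`).
* *Expansion.* Let `f y` be the square root of the probability of the public information outside
  coordinate `i`, given `x i = y`. The previous bound says that for a typical `i` and random `τ i`
  the function `f` hardly changes when the question of player `τ i` is resampled. This
  resampling is the random walk on the connection graph, so by the Poincaré inequality
  (`WeightedGraph.IsExpander.mul_variance_le`, `Game.mul_variance_le_sum_resample`) `f` is almost
  constant: the public information outside coordinate `i` is almost independent of the whole tuple
  `x i` (`Game.mul_sum_varianceAt_le`).
* *Simulation.* Hence in the game `G` itself the players can fix the public information in advance,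
  take their own questions as those of coordinate `i`, sample their remaining questions
  independently, and answer as in coordinate `i` of the repeated game. They win with almost the
  conditional probability of winning coordinate `i`, which is therefore not much more than `G.val`
  (`Game.sum_mul_condExpAt_div_le_val`, `Game.winOn_insert_le`).
-/

/-! ### Product distributions on finite sets -/

open Finset in
/-- Resampling one coordinate of a family with independent coordinates does not change its law. -/
theorem sum_prod_mul_sum_update {ι Q : Type*} [Fintype ι] [DecidableEq ι] [Fintype Q]
    (w : Q → ℝ) (i : ι) (φ : (ι → Q) → ℝ) :
    ∑ z : ι → Q, (∏ j, w (z j)) * ∑ y, w y * φ (Function.update z i y) =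
      (∑ y, w y) * ∑ z : ι → Q, (∏ j, w (z j)) * φ z := by
  -- Exchanging the `i`-th coordinate and the new value is an involution.
  let e : (ι → Q) × Q ≃ (ι → Q) × Q :=
    { toFun := fun p => (Function.update p.1 i p.2, p.1 i)
      invFun := fun p => (Function.update p.1 i p.2, p.1 i)
      left_inv := fun p => by simp
      right_inv := fun p => by simp }
  have h := Equiv.sum_comp e (fun p : (ι → Q) × Q => (∏ j, w (p.1 j)) * w p.2 * φ p.1)
  rw [Fintype.sum_prod_type, Fintype.sum_prod_type] at h
  calc ∑ z : ι → Q, (∏ j, w (z j)) * ∑ y, w y * φ (Function.update z i y)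
      = ∑ z : ι → Q, ∑ y, (∏ j, w (Function.update z i y j)) * w (z i) *
          φ (Function.update z i y) := by
        refine sum_congr rfl fun z _ => ?_
        rw [mul_sum]
        refine sum_congr rfl fun y _ => ?_
        rw [← mul_prod_erase univ _ (mem_univ i),
          ← mul_prod_erase univ (fun j => w (Function.update z i y j)) (mem_univ i),
          prod_congr rfl (fun j hj => by
            rw [Function.update_of_ne (ne_of_mem_erase hj)] :
            ∀ j ∈ univ.erase i, w (Function.update z i y j) = w (z j))]
        simp only [Function.update_self]
        ring
    _ = ∑ z : ι → Q, ∑ y, (∏ j, w (z j)) * w y * φ z := h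
    _ = (∑ y, w y) * ∑ z : ι → Q, (∏ j, w (z j)) * φ z := by
        rw [sum_comm, sum_mul]
        refine sum_congr rfl fun y _ => ?_
        rw [mul_sum]
        exact sum_congr rfl fun z _ => by ring

/-- The conditional expectation `E[e(x) | x i = y]` for `x` with independent coordinates
`x j ~ p j`. It is written without a division, so that it makes sense if `p i y = 0`. -/
noncomputable def condExpAt {ι Q : Type*} [Fintype ι] [DecidableEq ι] [Fintype Q]
    [DecidableEq Q] (p : ι → Q → ℝ) (e : (ι → Q) → ℝ) (i : ι) (y : Q) : ℝ :=
  ∑ x : ι → Q, if x i = y then (∏ j ∈ Finset.univ.erase i, p j (x j)) * e x else 0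

section CondExpAt

open Finset

variable {ι Q : Type*} [Fintype ι] [DecidableEq ι] [Fintype Q] [DecidableEq Q]
  {p : ι → Q → ℝ} {e : (ι → Q) → ℝ}

theorem condExpAt_nonneg (hp : ∀ j y, 0 ≤ p j y) (he : ∀ x, 0 ≤ e x) (i : ι) (y : Q) :
    0 ≤ condExpAt p e i y := by
  refine sum_nonneg fun x _ => ?_
  split_ifs
  · exact mul_nonneg (prod_nonneg fun j _ => hp _ _) (he x)
  · exact le_rfl

theorem condExpAt_congr {p' : ι → Q → ℝ} {i : ι}
    (h : ∀ j, j ≠ i → p j = p' j) (y : Q) : condExpAt p e i y = condExpAt p' e i y := by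
  refine sum_congr rfl fun x _ => ?_
  rw [prod_congr rfl fun j hj => by rw [h j (ne_of_mem_erase hj)]]

theorem condExpAt_congr_right {e' : (ι → Q) → ℝ} {i : ι} {y : Q}
    (h : ∀ x, x i = y → e x = e' x) : condExpAt p e i y = condExpAt p e' i y := by
  refine sum_congr rfl fun x _ => ?_
  split_ifs with hx
  · rw [h x hx]
  · rfl

/-- Averaging `E[e(x) u(x i) | x i = y]` over `y ~ q` amounts to replacing `p i` by `q`. -/
theorem sum_mul_condExpAt (q u : Q → ℝ) (i : ι) :
    ∑ y, q y * (condExpAt p e i y * u y) =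
      ∑ x : ι → Q, (∏ j, Function.update p i q j (x j)) * e x * u (x i) := by
  simp only [condExpAt, sum_mul, mul_sum]
  rw [sum_comm]
  refine sum_congr rfl fun x _ => ?_
  rw [sum_eq_single (x i)]
  · rw [if_pos rfl, ← mul_prod_erase univ _ (mem_univ i), Function.update_self,
      prod_congr rfl (fun j hj => by
        rw [Function.update_of_ne (ne_of_mem_erase hj)] :
        ∀ j ∈ univ.erase i, Function.update p i q j (x j) = p j (x j))]
    ring
  · intro y _ hy
    rw [if_neg (Ne.symm hy)]
    ring
  · simp

/-- The pointwise inequality behind the comparison of the squared Hellinger distance with the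
relative entropy. -/
theorem two_mul_sub_sqrt_mul_le {a b : ℝ} (ha : 0 ≤ a) (hb : 0 < b) :
    2 * (a - √a * √b) ≤ a * Real.log (a / b) := by
  rcases ha.eq_or_lt with rfl | ha
  · simp
  have hs : 0 < √a := Real.sqrt_pos.2 ha
  have ht : 0 < √b := Real.sqrt_pos.2 hb
  have h := Real.log_le_sub_one_of_pos (div_pos ht hs)
  have hlog : Real.log (a / b) = -2 * Real.log (√b / √a) := by
    rw [Real.log_div ha.ne' hb.ne', Real.log_div ht.ne' hs.ne', Real.log_sqrt hb.le,
      Real.log_sqrt ha.le]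
    ring
  have h2 : a * (√b / √a) = √a * √b := by
    field_simp
    rw [Real.sq_sqrt ha.le]
  rw [hlog]
  nlinarith [mul_le_mul_of_nonneg_left h ha.le]

/-- Conditioning a product distribution on an event of probability `N` moves its marginals by at
most `log (1 / N)` in total, measured in squared Hellinger distance. This is the subadditivity of
relative entropy; after the comparison of logarithms everything follows from
`∑ x, ∏ j, p j (x j) * u j (x j) = ∏ j, ∑ y, p j y * u j y` for the density ratios `u j`. -/
theorem sum_sq_sqrt_condExpAt_sub_le (hp : ∀ j y, 0 ≤ p j y) (hp1 : ∀ j, ∑ y, p j y ≤ 1)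
    (he : ∀ x, 0 ≤ e x) (he1 : ∀ x, e x ≤ 1) {N : ℝ}
    (hN : N = ∑ x : ι → Q, (∏ j, p j (x j)) * e x) :
    ∑ i, ∑ y, p i y * (√(condExpAt p e i y) - √N) ^ 2 ≤ Real.negMulLog N := by
  have hc := fun i y => condExpAt_nonneg (i := i) (y := y) hp he
  have hP : ∀ x : ι → Q, 0 ≤ ∏ j, p j (x j) := fun x => prod_nonneg fun j _ => hp _ _
  have hN0 : 0 ≤ N := hN ▸ sum_nonneg fun x _ => mul_nonneg (hP x) (he x)
  have hsum : ∀ i (u : Q → ℝ), ∑ y, p i y * (condExpAt p e i y * u y) =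
      ∑ x : ι → Q, (∏ j, p j (x j)) * e x * u (x i) := fun i u => by
    have := sum_mul_condExpAt (p := p) (e := e) (p i) u i
    rwa [Function.update_eq_self] at this
  have hsum1 : ∀ i, ∑ y, p i y * condExpAt p e i y = N := fun i => by
    have := hsum i fun _ => 1
    simpa [hN] using this
  rcases hN0.eq_or_lt with h0 | hpos
  · rw [← h0]
    simp only [Real.sqrt_zero, sub_zero, Real.negMulLog_zero]
    refine (sum_eq_zero fun i _ => ?_).le
    rw [← h0] at hsum1
    rw [← hsum1 i]
    exact sum_congr rfl fun y _ => by rw [Real.sq_sqrt (hc i y)]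
  set u : ι → Q → ℝ := fun i y => condExpAt p e i y / N with hu
  have hpe : ∀ x : ι → Q, 0 ≤ (∏ j, p j (x j)) * e x := fun x => mul_nonneg (hP x) (he x)
  calc ∑ i, ∑ y, p i y * (√(condExpAt p e i y) - √N) ^ 2
      ≤ ∑ i, ∑ y, p i y * (condExpAt p e i y * Real.log (u i y)) := by
        refine sum_le_sum fun i _ => ?_
        have h1 : ∑ y, p i y * (√(condExpAt p e i y) - √N) ^ 2 =
            (∑ y, p i y * (2 * (condExpAt p e i y - √(condExpAt p e i y) * √N))) +
              N * (∑ y, p i y) - ∑ y, p i y * condExpAt p e i y := by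
          rw [mul_sum, ← sum_add_distrib, ← sum_sub_distrib]
          refine sum_congr rfl fun y _ => ?_
          rw [sub_sq, Real.sq_sqrt (hc i y), Real.sq_sqrt hN0]
          ring
        rw [h1, hsum1 i]
        have h2 : ∑ y, p i y * (2 * (condExpAt p e i y - √(condExpAt p e i y) * √N)) ≤
            ∑ y, p i y * (condExpAt p e i y * Real.log (u i y)) :=
          sum_le_sum fun y _ => mul_le_mul_of_nonneg_left
            (two_mul_sub_sqrt_mul_le (hc i y) hpos) (hp i y)
        nlinarith [hp1 i]
    _ = ∑ x : ι → Q, (∏ j, p j (x j)) * e x * ∑ i, Real.log (u i (x i)) := by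
        simp_rw [hsum _ fun y => Real.log (u _ y), mul_sum]
        exact sum_comm
    _ ≤ ∑ x : ι → Q, ((∏ j, p j (x j) * u j (x j)) * N
          - (∏ j, p j (x j)) * e x * (1 + Real.log N)) := by
        refine sum_le_sum fun x _ => ?_
        rcases (hpe x).eq_or_lt with h | h
        · rw [← h]
          simpa using mul_nonneg
            (prod_nonneg fun j _ => mul_nonneg (hp j (x j)) (div_nonneg (hc j (x j)) hN0)) hN0
        · -- `x` itself contributes to each of the conditional expectations.
          have hupos : ∀ i, 0 < u i (x i) := fun i => by
            refine div_pos (lt_of_lt_of_le ?_ (single_le_sum (f := fun x' : ι → Q =>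
              if x' i = x i then (∏ j ∈ univ.erase i, p j (x' j)) * e x' else 0)
              (fun x' _ => ?_) (mem_univ x))) hpos
            · rw [if_pos rfl]
              rw [← mul_prod_erase univ _ (mem_univ i)] at h
              have hA := prod_nonneg (s := univ.erase i) (fun j _ => hp j (x j))
              refine (mul_nonneg hA (he x)).lt_of_ne fun h' => ?_
              rw [mul_assoc, ← h', mul_zero] at h
              exact h.false
            · split_ifs
              · exact mul_nonneg (prod_nonneg fun j _ => hp _ _) (he x')
              · exact le_rfl
          rw [← Real.log_prod fun i _ => (hupos i).ne', prod_mul_distrib]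
          have hU : 0 < ∏ i, u i (x i) := prod_pos fun i _ => hupos i
          have hlog := Real.log_le_sub_one_of_pos (mul_pos hU hpos)
          rw [Real.log_mul hU.ne' hpos.ne'] at hlog
          have h3 : (∏ j, p j (x j)) * e x * ((∏ i, u i (x i)) * N) ≤
              (∏ j, p j (x j)) * (∏ i, u i (x i)) * N := by
            have := mul_le_mul_of_nonneg_left (he1 x)
              (mul_nonneg (hP x) (mul_pos hU hpos).le)
            linarith
          nlinarith [mul_le_mul_of_nonneg_left hlog h.le]
    _ = (∏ j, ∑ y, p j y * u j y) * N - N * (1 + Real.log N) := by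
        rw [sum_sub_distrib, ← sum_mul, ← sum_mul, ← hN, Fintype.prod_sum]
    _ = Real.negMulLog N := by
        have : ∀ j, ∑ y, p j y * u j y = 1 := fun j => by
          have h4 : ∑ y, p j y * u j y = (∑ y, p j y * condExpAt p e j y) / N := by
            rw [sum_div]
            exact sum_congr rfl fun y _ => by simp only [hu]; ring
          rw [h4, hsum1, div_self hpos.ne']
        simp only [this, prod_const_one, Real.negMulLog]
        ring

/-- Jensen's inequality for `Real.negMulLog`, with unnormalized weights. -/
theorem sum_mul_negMulLog_le {α : Type*} (s : Finset α) {ν N : α → ℝ} {w B : ℝ}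
    (hν : ∀ a ∈ s, 0 ≤ ν a) (hN : ∀ a ∈ s, 0 ≤ N a) (hw : ∑ a ∈ s, ν a * N a = w) (hw0 : 0 < w)
    (hB : ∑ a ∈ s, ν a ≤ B) (hB0 : 0 < B) :
    ∑ a ∈ s, ν a * Real.negMulLog (N a) ≤ w * Real.log (B / w) := by
  have hM : 0 < w / B := div_pos hw0 hB0
  calc ∑ a ∈ s, ν a * Real.negMulLog (N a)
      ≤ ∑ a ∈ s, (ν a * (w / B) - ν a * N a - ν a * N a * Real.log (w / B)) := by
        refine sum_le_sum fun a ha => ?_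
        have h : Real.negMulLog (N a) ≤ w / B - N a - N a * Real.log (w / B) := by
          rcases (hN a ha).eq_or_lt with h0 | h0
          · rw [← h0]
            simpa using hM.le
          · have := Real.log_le_sub_one_of_pos (div_pos hM h0)
            rw [Real.log_div hM.ne' h0.ne'] at this
            have h2 := mul_le_mul_of_nonneg_left this h0.le
            have h3 : N a * (w / B / N a - 1) = w / B - N a := by field_simp
            rw [h3] at h2
            rw [Real.negMulLog]
            linarith
        have := mul_le_mul_of_nonneg_left h (hν a ha)
        linarith
    _ = (∑ a ∈ s, ν a) * (w / B) - w - w * Real.log (w / B) := by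
        rw [sum_sub_distrib, sum_sub_distrib, ← sum_mul, ← sum_mul, hw]
    _ ≤ w * Real.log (B / w) := by
        have h1 : (∑ a ∈ s, ν a) * (w / B) ≤ B * (w / B) := mul_le_mul_of_nonneg_right hB hM.le
        rw [mul_div_cancel₀ _ hB0.ne'] at h1
        have h2 : Real.log (B / w) = -Real.log (w / B) := by rw [← Real.log_inv, inv_div]
        rw [h2]
        linarith

end CondExpAt

/-! ### The spectral gap -/

namespace Matrix.IsHermitian

open Finset

/-- A real symmetric matrix with a vector `v` in its kernel, all of whose eigenvalues but the
smallest one are at least `l > 0`, satisfies `l * ‖f‖² ≤ ⟨f, L f⟩` for all `f` orthogonal to `v`: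
such a `v` has to be a multiple of the eigenvector of the smallest eigenvalue. -/
theorem mul_dotProduct_le_of_kernel {n : Type*} [Fintype n] [DecidableEq n] {L : Matrix n n ℝ}
    (hL : L.IsHermitian) {l : ℝ} (hl : 0 < l) {v : n → ℝ} (hv0 : v ≠ 0) (hLv : L *ᵥ v = 0)
    (h : ∀ hc : 2 ≤ Fintype.card n, l ≤ hL.eigenvalues₀ ⟨Fintype.card n - 2, by omega⟩)
    {f : n → ℝ} (hf : f ⬝ᵥ v = 0) : l * (f ⬝ᵥ f) ≤ f ⬝ᵥ (L *ᵥ f) := by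
  have hcard : 0 < Fintype.card n := by
    obtain ⟨i, -⟩ := Function.ne_iff.1 hv0
    exact Fintype.card_pos_iff.2 ⟨i⟩
  set b := hL.eigenvectorBasis with hb
  set o : n := Fintype.equivOfCardEq (Fintype.card_fin (Fintype.card n))
    ⟨Fintype.card n - 1, by omega⟩ with ho
  have hev : ∀ i, i ≠ o → l ≤ hL.eigenvalues i := fun i hi => by
    set m := (Fintype.equivOfCardEq (Fintype.card_fin (Fintype.card n))).symm i with hm
    have hmi : hL.eigenvalues i = hL.eigenvalues₀ m := rfl
    have hne : m ≠ ⟨Fintype.card n - 1, by omega⟩ := fun hmo => hi <| by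
      rw [ho, ← hmo, hm, Equiv.apply_symm_apply]
    have hlt : (m : ℕ) ≠ Fintype.card n - 1 := fun h' => hne (Fin.ext h')
    have hm2 := m.2
    rw [hmi]
    refine (h (by omega)).trans (hL.eigenvalues₀_antitone ?_)
    rw [Fin.le_def]
    change (m : ℕ) ≤ Fintype.card n - 2
    omega
  -- coordinates in the eigenbasis
  set c : (n → ℝ) → n → ℝ := fun g i => (b i : n → ℝ) ⬝ᵥ g with hcdef
  have hinner : ∀ g g' : n → ℝ, g ⬝ᵥ g' = ∑ i, c g i * c g' i := fun g g' => by
    have := b.sum_inner_mul_inner (WithLp.toLp 2 g) (WithLp.toLp 2 g')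
    simp only [EuclideanSpace.inner_eq_star_dotProduct, star_trivial] at this
    rw [dotProduct_comm, ← this]
    refine sum_congr rfl fun i _ => ?_
    simp only [hcdef]
    rw [dotProduct_comm g']
  have hLc : ∀ g i, c (L *ᵥ g) i = hL.eigenvalues i * c g i := fun g i => by
    simp only [hcdef]
    rw [dotProduct_mulVec, ← mulVec_transpose]
    have : Lᵀ = L := by simpa [conjTranspose_eq_transpose_of_trivial] using hL.eq
    rw [this, hL.mulVec_eigenvectorBasis, smul_dotProduct, smul_eq_mul]
  have hvc : ∀ i, i ≠ o → c v i = 0 := fun i hi => by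
    have h1 := hLc v i
    rw [hLv] at h1
    have h2 : c 0 i = 0 := by simp [hcdef]
    rw [h2] at h1
    exact (mul_eq_zero.1 h1.symm).resolve_left (hl.trans_le (hev i hi)).ne'
  have hvo : c v o ≠ 0 := fun h0 => hv0 <| by
    have : v ⬝ᵥ v = 0 := by
      rw [hinner]
      refine sum_eq_zero fun i _ => ?_
      by_cases hi : i = o
      · rw [hi, h0, mul_zero]
      · rw [hvc i hi, mul_zero]
    exact dotProduct_self_eq_zero.1 this
  have hfo : c f o = 0 := by
    rw [hinner, sum_eq_single o (fun i _ hi => by rw [hvc i hi, mul_zero]) (by simp)] at hf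
    exact (mul_eq_zero.1 hf).resolve_right hvo
  rw [hinner, hinner, mul_sum]
  refine sum_le_sum fun i _ => ?_
  rw [hLc]
  by_cases hi : i = o
  · rw [hi, hfo]; simp
  · nlinarith [hev i hi, mul_self_nonneg (c f i)]

end Matrix.IsHermitian

namespace WeightedGraph

open Finset

/-- The Poincaré inequality of an expander whose weights form a probability distribution: the
variance of a function under the degree distribution is at most `1 / l` times its energy. -/
theorem IsExpander.mul_variance_le {W : Type*} [Fintype W] {H : WeightedGraph W} {l : ℝ}
    (hH : H.IsExpander l) (hl : 0 < l) (hsum : ∑ u, H.degree u = 1) (g : W → ℝ) :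
    l * ∑ u, H.degree u * (g u - ∑ v, H.degree v * g v) ^ 2 ≤
      ∑ u, H.degree u * g u ^ 2 - ∑ u, ∑ v, H.weight u v * (g u * g v) := by
  classical
  have hd0 : ∀ u, 0 ≤ H.degree u := fun u => sum_nonneg fun v _ => H.weight_nonneg u v
  have hw0 : ∀ u v, H.degree u = 0 → H.weight u v = 0 := fun u v h =>
    (sum_eq_zero_iff_of_nonneg fun v _ => H.weight_nonneg u v).1 h v (mem_univ v)
  have hw0' : ∀ u v, H.degree v = 0 → H.weight u v = 0 := fun u v h => by
    rw [H.weight_symm, hw0 v u h]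
  have hsub : ∀ φ : W → ℝ, (∀ u, H.degree u = 0 → φ u = 0) →
      ∑ u : H.Support, φ u = ∑ u, φ u := fun φ hφ => by
    rw [← Finset.sum_subtype (univ.filter fun u => H.degree u ≠ 0) (by simp) φ]
    exact sum_filter_of_ne fun u _ hu hd => hu (hφ u hd)
  have hr : ∀ u : H.Support, 0 < √(H.degree u) := fun u =>
    Real.sqrt_pos.2 ((hd0 u).lt_of_ne u.2.symm)
  have hsq : ∀ u, √(H.degree u) * √(H.degree u) = H.degree u := fun u =>
    Real.mul_self_sqrt (hd0 u)
  -- the Laplacian in the coordinates `√(degree) * φ`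
  have hlap : ∀ (φ : W → ℝ) (u : H.Support),
      (H.supportLaplacian.mulVec fun v => √(H.degree v) * φ v) u =
        √(H.degree u) * φ u - (∑ v, H.weight u v * φ v) / √(H.degree u) := fun φ u => by
    have hentry : ∀ v : H.Support, H.supportLaplacian u v * (√(H.degree v) * φ v) =
        (if v = u then √(H.degree v) * φ v else 0) - H.weight u v * φ v / √(H.degree u) := by
      intro v
      have hu := hr u
      have hv := hr v
      simp only [supportLaplacian, Matrix.submatrix_apply, normalizedLaplacian]
      by_cases huv : v = u
      · subst huv
        rw [if_pos ⟨rfl, v.2⟩, if_pos rfl]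
        have := Real.sqrt_div_self (x := H.degree v)
        rw [div_eq_mul_inv _ √(H.degree v), ← this]
        ring
      · rw [if_neg fun h' => huv (Subtype.ext h'.1.symm), if_pos ⟨u.2, v.2⟩, if_neg huv,
          Real.sqrt_mul (hd0 u)]
        field_simp
        ring
    simp only [Matrix.mulVec, dotProduct, hentry]
    rw [sum_sub_distrib, sum_ite_eq' univ u, if_pos (mem_univ u), ← sum_div,
      hsub (fun v => H.weight u v * φ v) fun v hv => by rw [hw0' _ _ hv, zero_mul]]
  set m := ∑ v, H.degree v * g v with hm
  have key := H.supportLaplacian_isHermitian.mul_dotProduct_le_of_kernel hl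
    (v := fun v => √(H.degree v) * 1) (f := fun v => √(H.degree v) * (g v - m)) ?_ ?_ ?_ ?_
  · have e1 : ∑ v : H.Support, √(H.degree v) * (g v - m) * (√(H.degree v) * (g v - m)) =
        ∑ u, H.degree u * (g u - m) ^ 2 := by
      rw [← hsub (fun u => H.degree u * (g u - m) ^ 2) fun u hu => by rw [hu, zero_mul]]
      exact sum_congr rfl fun u _ => by linear_combination (g u - m) ^ 2 * hsq u
    have e2 : (fun v : H.Support => √(H.degree v) * (g v - m)) ⬝ᵥ (H.supportLaplacian.mulVec
        fun v : H.Support => √(H.degree v) * (g v - m)) =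
        ∑ u, (H.degree u * (g u - m) ^ 2 -
          (g u - m) * ∑ v, H.weight u v * (g v - m)) := by
      rw [← hsub (fun u => H.degree u * (g u - m) ^ 2 -
          (g u - m) * ∑ v, H.weight u v * (g v - m)) fun u hu => by
        simp [hu, hw0 u _ hu]]
      refine sum_congr rfl fun u _ => ?_
      rw [hlap (fun v => g v - m) u]
      have h1 := div_self (hr u).ne'
      linear_combination (g u - m) ^ 2 * hsq u -
        (g u - m) * (∑ v, H.weight u v * (g v - m)) * h1
    have e3 : ∑ u, (H.degree u * (g u - m) ^ 2 -
          (g u - m) * ∑ v, H.weight u v * (g v - m)) =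
        ∑ u, H.degree u * g u ^ 2 - ∑ u, ∑ v, H.weight u v * (g u * g v) := by
      have a1 : ∑ u, ∑ v, H.weight u v * g v = m := by
        rw [sum_comm, hm]
        refine sum_congr rfl fun v _ => ?_
        rw [degree, sum_mul]
        exact sum_congr rfl fun u _ => by rw [H.weight_symm]
      have a2 : ∀ u, H.degree u * (g u - m) ^ 2 - (g u - m) * ∑ v, H.weight u v * (g v - m) =
          H.degree u * g u ^ 2 - ∑ v, H.weight u v * (g u * g v)
            - m * (H.degree u * g u) + m * ∑ v, H.weight u v * g v := fun u => by
        have b1 : ∑ v, H.weight u v * (g v - m) = ∑ v, H.weight u v * g v - H.degree u * m := by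
          rw [degree, sum_mul, ← sum_sub_distrib]
          exact sum_congr rfl fun v _ => by ring
        have b2 : ∑ v, H.weight u v * (g u * g v) = g u * ∑ v, H.weight u v * g v := by
          rw [mul_sum]
          exact sum_congr rfl fun v _ => by ring
        rw [b1, b2]
        ring
      rw [sum_congr rfl fun u _ => a2 u, sum_add_distrib, sum_sub_distrib, sum_sub_distrib,
        ← mul_sum, ← mul_sum, a1, ← hm]
      ring
    rw [← e3, ← e2, ← e1]
    exact key
  · intro h0
    have : ∑ u, H.degree u = 0 := by
      rw [← hsub _ fun u hu => hu]
      refine sum_eq_zero fun u _ => ?_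
      have := congrFun h0 u
      exact absurd (by simpa using this) (hr u).ne'
    rw [hsum] at this
    exact one_ne_zero this
  · funext u
    rw [hlap (fun _ => 1) u]
    simp only [mul_one, Pi.zero_apply]
    change √(H.degree u) - H.degree u / √(H.degree u) = 0
    rw [Real.div_sqrt, sub_self]
  · intro hc
    have h1 := hH
    rw [IsExpander, secondEigenvalue, dif_pos hc, EReal.coe_le_coe_iff] at h1
    exact h1
  · have : (∑ u : H.Support, √(H.degree u) * (g u - m) * (√(H.degree u) * 1)) =
        ∑ u, H.degree u * (g u - m) := by
      rw [← hsub (fun u => H.degree u * (g u - m)) fun u hu => by rw [hu, zero_mul]]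
      exact sum_congr rfl fun u _ => by linear_combination (g u - m) * hsq u
    refine this.trans ?_
    simp only [mul_sub]
    rw [sum_sub_distrib, ← sum_mul, hsum, one_mul, ← hm, sub_self]

end WeightedGraph

/-! ### Resampling the question of one player -/

namespace Game

open Finset

variable {k : ℕ} {X : Fin k → Type*} {A : Fin k → Type*} [∀ t, Fintype (X t)]

open Classical in
/-- The factor of player `s` in the transition probability `G.resample t z`. -/
noncomputable def resampleFactor (G : Game k X A) (t : Fin k) (z : ∀ t, X t) (s : Fin k)
    (q : X s) : ℝ :=
  if s = t then G.condProb s (Function.update z s q) else if z s = q then 1 else 0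

/-- The probability of passing from `z` to `x` when the question of player `t` is resampled
conditionally on the questions of the other players. It is the product over the players of the
factors `resampleFactor`; from a `z` with `G.probOthers t z = 0` nothing is reached. -/
noncomputable def resample (G : Game k X A) (t : Fin k) (z x : ∀ t, X t) : ℝ :=
  ∏ s, G.resampleFactor t z s (x s)

theorem resampleFactor_nonneg (G : Game k X A) (t : Fin k) (z : ∀ t, X t) (s : Fin k) (q : X s) :
    0 ≤ G.resampleFactor t z s q := by
  unfold resampleFactor
  split_ifs
  · exact G.condProb_nonneg _ _
  · exact zero_le_one
  · exact le_rfl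

theorem resample_of_agree (G : Game k X A) {t : Fin k} {z x : ∀ t, X t}
    (h : ∀ s, s ≠ t → z s = x s) : G.resample t z x = G.condProb t x := by
  have hx : Function.update z t (x t) = x := by
    funext s
    by_cases hs : s = t
    · subst hs; simp
    · simp [hs, h s hs]
  rw [resample, prod_eq_single t]
  · rw [resampleFactor, if_pos rfl, hx]
  · intro s _ hs
    rw [resampleFactor, if_neg hs, if_pos (h s hs)]
  · simp

theorem resample_of_not_agree (G : Game k X A) {t : Fin k} {z x : ∀ t, X t}
    (h : ¬ ∀ s, s ≠ t → z s = x s) : G.resample t z x = 0 := by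
  push Not at h
  obtain ⟨s, hs, hne⟩ := h
  exact prod_eq_zero (mem_univ s) (by rw [resampleFactor, if_neg hs, if_neg hne])

theorem sum_resample (G : Game k X A) (t : Fin k) (z : ∀ t, X t) :
    ∑ x, G.resample t z x = G.probOthers t z / G.probOthers t z := by
  classical
  simp only [resample]
  rw [← Fintype.prod_sum, prod_eq_single t]
  · have h : ∀ q, G.probOthers t (Function.update z t q) = G.probOthers t z := fun q =>
      G.probOthers_congr t fun s hs => Function.update_of_ne hs _ _
    simp only [resampleFactor, if_pos, condProb, h]
    rw [← sum_div, probOthers]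
  · intro s _ hs
    simp [resampleFactor, hs]
  · simp

theorem sum_resample_le_one (G : Game k X A) (t : Fin k) (z : ∀ t, X t) :
    ∑ x, G.resample t z x ≤ 1 := by
  rw [sum_resample]
  exact div_self_le_one _

theorem μ_le_probOthers (G : Game k X A) (t : Fin k) (x : ∀ t, X t) :
    G.μ x ≤ G.probOthers t x := by
  have := single_le_sum (f := fun q => G.μ (Function.update x t q))
    (fun q _ => G.μ_nonneg _) (mem_univ (x t))
  rwa [Function.update_eq_self] at this

theorem probOthers_mul_condProb (G : Game k X A) (t : Fin k) (x : ∀ t, X t) :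
    G.probOthers t x * G.condProb t x = G.μ x := by
  rcases eq_or_ne (G.probOthers t x) 0 with h | h
  · have := G.μ_le_probOthers t x
    rw [h, zero_mul]
    linarith [G.μ_nonneg x]
  · rw [condProb, mul_div_cancel₀ _ h]

theorem μ_mul_sum_resample (G : Game k X A) (t : Fin k) (z : ∀ t, X t) :
    G.μ z * ∑ x, G.resample t z x = G.μ z := by
  rw [sum_resample]
  rcases eq_or_ne (G.probOthers t z) 0 with h | h
  · have := G.μ_le_probOthers t z
    have h0 : G.μ z = 0 := by linarith [G.μ_nonneg z]
    rw [h0, zero_mul]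
  · rw [div_self h, mul_one]

/-- Detailed balance. -/
theorem μ_mul_resample_comm (G : Game k X A) (t : Fin k) (z x : ∀ t, X t) :
    G.μ z * G.resample t z x = G.μ x * G.resample t x z := by
  by_cases h : ∀ s, s ≠ t → z s = x s
  · rw [G.resample_of_agree h, G.resample_of_agree fun s hs => (h s hs).symm,
      ← G.probOthers_mul_condProb t z, ← G.probOthers_mul_condProb t x, G.probOthers_congr t h]
    ring
  · rw [G.resample_of_not_agree h,
      G.resample_of_not_agree fun h' => h fun s hs => (h' s hs).symm, mul_zero, mul_zero]

theorem sum_μ_mul_resample (G : Game k X A) (t : Fin k) (x : ∀ t, X t) :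
    ∑ z, G.μ z * G.resample t z x = G.μ x := by
  simp_rw [G.μ_mul_resample_comm t _ x]
  rw [← mul_sum, μ_mul_sum_resample]

/-- The weights of the connection graph are those of the random walk that resamples the question of
a random player. -/
theorem connectionWeight_eq (G : Game k X A) (x y : ∀ t, X t) :
    G.connectionWeight x y = (1 / (k : ℝ)) * ∑ t, G.μ x * G.resample t x y := by
  classical
  unfold connectionWeight
  split_ifs with h
  · subst h
    rw [mul_sum]
    congr 1
    exact sum_congr rfl fun t _ => by rw [G.resample_of_agree fun _ _ => rfl]
  · rw [sum_filter, mul_sum]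
    refine sum_congr rfl fun t _ => ?_
    by_cases ht : ∀ s, s ≠ t → x s = y s
    · have hne : x t ≠ y t := fun he => h <| by
        funext s
        by_cases hs : s = t
        · subst hs; exact he
        · exact ht s hs
      rw [if_pos ⟨ht, hne⟩, G.resample_of_agree ht, G.probOthers_mul_condProb]
    · rw [if_neg fun h' => ht h'.1, G.resample_of_not_agree ht, mul_zero, mul_zero]

theorem connectionGraph_degree (G : Game k X A) (hk : k ≠ 0) (x : ∀ t, X t) :
    G.connectionGraph.degree x = G.μ x := by
  change ∑ y, G.connectionWeight x y = _
  simp_rw [connectionWeight_eq]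
  rw [← mul_sum, sum_comm]
  rw [sum_congr rfl fun t _ => by rw [← mul_sum, μ_mul_sum_resample]]
  have : (k : ℝ) ≠ 0 := Nat.cast_ne_zero.2 hk
  simp only [sum_const, card_univ, Fintype.card_fin, nsmul_eq_mul]
  field_simp

/-- The law after the resampling depends only on the questions of the other players; in particular
resampling twice is the same as resampling once. -/
theorem sum_resample_mul_congr (G : Game k X A) (t : Fin k) {z x : ∀ t, X t}
    (h : ∀ s, s ≠ t → z s = x s) (f : (∀ t, X t) → ℝ) :
    ∑ y, G.resample t z y * f y = ∑ y, G.resample t x y * f y := by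
  refine sum_congr rfl fun y _ => ?_
  congr 1
  by_cases hy : ∀ s, s ≠ t → z s = y s
  · rw [G.resample_of_agree hy, G.resample_of_agree fun s hs => (h s hs).symm.trans (hy s hs)]
  · rw [G.resample_of_not_agree hy,
      G.resample_of_not_agree fun h' => hy fun s hs => (h s hs).trans (h' s hs)]

/-- The conditional variance of `f` given the questions of all the players but `t` is at most the
mean square distance of `f` from any function `c` of the question tuple before the resampling. -/
theorem energy_le (G : Game k X A) (t : Fin k) (f c : (∀ t, X t) → ℝ) :
    ∑ x, G.μ x * f x ^ 2 - ∑ x, ∑ y, G.μ x * G.resample t x y * (f x * f y) ≤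
      ∑ x, G.μ x * ∑ y, G.resample t x y * (f y - c x) ^ 2 := by
  set T : (∀ t, X t) → ℝ := fun x => ∑ y, G.resample t x y * f y with hT
  have hstat : ∀ φ : (∀ t, X t) → ℝ,
      ∑ x, ∑ y, G.μ x * G.resample t x y * φ y = ∑ y, G.μ y * φ y := fun φ => by
    rw [sum_comm]
    refine sum_congr rfl fun y _ => ?_
    rw [← sum_mul, sum_μ_mul_resample]
  have hTT : ∑ x, ∑ y, G.μ x * G.resample t x y * (f x * f y) = ∑ x, G.μ x * T x ^ 2 := by
    calc ∑ x, ∑ y, G.μ x * G.resample t x y * (f x * f y)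
        = ∑ x, G.μ x * (f x * T x) := by
          refine sum_congr rfl fun x _ => ?_
          simp only [hT, mul_sum]
          exact sum_congr rfl fun y _ => by ring
      _ = ∑ x, ∑ y, G.μ x * G.resample t x y * (f y * T y) := (hstat fun y => f y * T y).symm
      _ = ∑ x, G.μ x * T x ^ 2 := by
          refine sum_congr rfl fun x _ => ?_
          have h1 : ∀ y, G.μ x * G.resample t x y * (f y * T y) =
              G.μ x * T x * (G.resample t x y * f y) := fun y => by
            by_cases h : ∀ s, s ≠ t → x s = y s
            · rw [show T y = T x from (G.sum_resample_mul_congr t h f).symm]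
              ring
            · rw [G.resample_of_not_agree h]
              ring
          rw [sum_congr rfl fun y _ => h1 y, ← mul_sum]
          change G.μ x * T x * T x = _
          ring
  rw [hTT, ← hstat fun y => f y ^ 2, ← sum_sub_distrib]
  refine sum_le_sum fun x _ => ?_
  have h2 : G.μ x * ∑ y, G.resample t x y * (f y - c x) ^ 2 =
      ∑ y, G.μ x * G.resample t x y * f y ^ 2 - 2 * c x * (G.μ x * T x)
        + c x ^ 2 * (G.μ x * ∑ y, G.resample t x y) := by
    simp only [hT, mul_sum]
    rw [← sum_sub_distrib, ← sum_add_distrib]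
    exact sum_congr rfl fun y _ => by ring
  rw [h2, μ_mul_sum_resample]
  nlinarith [mul_nonneg (G.μ_nonneg x) (sq_nonneg (T x - c x))]

/-- The Poincaré inequality for resampling the question of a random player. -/
theorem mul_variance_le_sum_resample (G : Game k X A) (hk : k ≠ 0) {l : ℝ} (hl : 0 < l)
    (hG : G.connectionGraph.IsExpander l) (f : (∀ t, X t) → ℝ)
    (c : Fin k → (∀ t, X t) → ℝ) :
    l * (k * ∑ x, G.μ x * (f x - ∑ y, G.μ y * f y) ^ 2) ≤
      ∑ t, ∑ x, G.μ x * ∑ y, G.resample t x y * (f y - c t x) ^ 2 := by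
  have hk' : (k : ℝ) ≠ 0 := Nat.cast_ne_zero.2 hk
  have hdeg := G.connectionGraph_degree hk
  have h := hG.mul_variance_le hl (by simp_rw [hdeg, G.μ_sum]) f
  simp_rw [hdeg] at h
  have hw : ∑ x, ∑ y, G.connectionGraph.weight x y * (f x * f y) =
      (1 / (k : ℝ)) * ∑ t, ∑ x, ∑ y, G.μ x * G.resample t x y * (f x * f y) := by
    change ∑ x, ∑ y, G.connectionWeight x y * (f x * f y) = _
    rw [mul_sum]
    simp_rw [connectionWeight_eq, mul_sum, sum_mul]
    refine ((sum_congr rfl fun x _ => sum_comm).trans sum_comm).trans ?_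
    exact sum_congr rfl fun t _ => sum_congr rfl fun x _ => sum_congr rfl fun y _ => by ring
  rw [hw] at h
  have h3 := mul_le_mul_of_nonneg_left h (Nat.cast_nonneg (α := ℝ) k)
  have h4 := sum_le_sum fun t (_ : t ∈ (univ : Finset (Fin k))) => G.energy_le t f (c t)
  rw [sum_sub_distrib] at h4
  simp only [sum_const, card_univ, Fintype.card_fin, nsmul_eq_mul] at h4
  rw [mul_sub, ← mul_assoc (k : ℝ) (1 / (k : ℝ)), mul_one_div_cancel hk', one_mul] at h3
  linarith

end Game

/-! ### Randomized strategies -/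

namespace Game

open Finset

variable {k : ℕ} {X : Fin k → Type*} {A : Fin k → Type*} [∀ t, Fintype (X t)]

theorem winProb_le_val [∀ t, Finite (A t)] (G : Game k X A) (f : ∀ t, X t → A t) :
    G.winProb f ≤ G.val :=
  le_ciSup (f := fun f => G.winProb f) (Set.finite_range _).bddAbove f

theorem nonempty_question (G : Game k X A) (t : Fin k) : Nonempty (X t) := by
  by_contra h
  have := G.μ_sum
  have : IsEmpty (∀ t, X t) := ⟨fun x => h ⟨x t⟩⟩
  simp at *

/-- Drawing the answers of a player to all the questions independently in advance yields, for each
question tuple `x`, the same joint law as drawing only the answers that are needed. -/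
theorem sum_prod_prod_mul_eval {Y : Fin k → Type*} [∀ s, Fintype (Y s)]
    [∀ s, DecidableEq (X s)] {σ : ∀ s, X s → Y s → ℝ} (hσ1 : ∀ s q, ∑ b, σ s q b = 1)
    (x : ∀ s, X s) (φ : (∀ s, Y s) → ℝ) :
    ∑ H : ∀ s, X s → Y s, (∏ s, ∏ q, σ s q (H s q)) * φ (fun s => H s (x s)) =
      ∑ b : ∀ s, Y s, (∏ s, σ s (x s) (b s)) * φ b := by
  classical
  have hmarg : ∀ b : ∀ s, Y s, ∑ H : ∀ s, X s → Y s, (∏ s, ∏ q, σ s q (H s q)) *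
      (if (fun s => H s (x s)) = b then 1 else 0) = ∏ s, σ s (x s) (b s) := fun b => by
    have h1 : ∀ H : ∀ s, X s → Y s, (∏ s, ∏ q, σ s q (H s q)) *
        (if (fun s => H s (x s)) = b then 1 else 0) =
        ∏ s, ∏ q, (σ s q (H s q) * if q = x s then (if H s q = b s then 1 else 0) else 1) := by
      intro H
      simp_rw [prod_mul_distrib]
      congr 1
      simp_rw [prod_ite_eq' univ, if_pos (mem_univ _)]
      rw [Finset.prod_boole]
      simp [funext_iff]
    rw [sum_congr rfl fun H _ => h1 H, ← Fintype.prod_sum (fun s (h : X s → Y s) =>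
      ∏ q, (σ s q (h q) * if q = x s then (if h q = b s then 1 else 0) else 1))]
    refine prod_congr rfl fun s _ => ?_
    rw [← Fintype.prod_sum (fun q (a : Y s) =>
      σ s q a * if q = x s then (if a = b s then 1 else 0) else 1), prod_eq_single (x s)]
    · simp
    · intro q _ hq
      simp [hq, hσ1]
    · simp
  calc ∑ H : ∀ s, X s → Y s, (∏ s, ∏ q, σ s q (H s q)) * φ (fun s => H s (x s))
      = ∑ H : ∀ s, X s → Y s, ∑ b, (∏ s, ∏ q, σ s q (H s q)) *
          (if (fun s => H s (x s)) = b then 1 else 0) * φ b := by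
        refine sum_congr rfl fun H _ => ?_
        rw [sum_eq_single (fun s => H s (x s))]
        · simp
        · intro b _ hb
          simp [Ne.symm hb]
        · simp
    _ = ∑ b : ∀ s, Y s, (∏ s, σ s (x s) (b s)) * φ b := by
        rw [sum_comm]
        exact sum_congr rfl fun b _ => by rw [← sum_mul, hmarg]

/-- Private randomness does not help: player `s` draws `b : Y s` with the probability `σ s q b` on
the question `q`, and answers `F s b`. -/
theorem sum_stochastic_le_val [∀ t, Finite (A t)] (G : Game k X A) {Y : Fin k → Type*}
    [∀ s, Fintype (Y s)] {σ : ∀ s, X s → Y s → ℝ} (hσ : ∀ s q b, 0 ≤ σ s q b)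
    (hσ1 : ∀ s q, ∑ b, σ s q b = 1) (F : ∀ s, Y s → A s) :
    ∑ x, G.μ x * ∑ b : ∀ s, Y s, (∏ s, σ s (x s) (b s)) *
      (if G.V x (fun s => F s (b s)) = true then 1 else 0) ≤ G.val := by
  classical
  calc ∑ x, G.μ x * ∑ b : ∀ s, Y s, (∏ s, σ s (x s) (b s)) *
        (if G.V x (fun s => F s (b s)) = true then 1 else 0)
      = ∑ H : ∀ s, X s → Y s, (∏ s, ∏ q, σ s q (H s q)) *
          G.winProb fun s q => F s (H s q) := by
        simp_rw [winProb, mul_sum]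
        rw [sum_comm (s := (univ : Finset (∀ s, X s → Y s)))]
        refine sum_congr rfl fun x _ => ?_
        rw [← mul_sum, ← sum_prod_prod_mul_eval hσ1 x fun b =>
          if G.V x (fun s => F s (b s)) = true then 1 else 0, mul_sum]
        refine sum_congr rfl fun H _ => ?_
        split_ifs <;> ring
    _ ≤ ∑ H : ∀ s, X s → Y s, (∏ s, ∏ q, σ s q (H s q)) * G.val :=
        sum_le_sum fun H _ => mul_le_mul_of_nonneg_left (G.winProb_le_val _)
          (prod_nonneg fun s _ => prod_nonneg fun q _ => hσ _ _ _)
    _ = G.val := by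
        rw [← sum_mul, ← Fintype.prod_sum (fun s (h : X s → Y s) => ∏ q, σ s q (h q))]
        simp_rw [← Fintype.prod_sum (fun q (a : Y _) => σ _ q a), hσ1, prod_const_one, one_mul]

theorem sum_substochastic_le_val [∀ t, Finite (A t)] (G : Game k X A) {Y : Fin k → Type*}
    [∀ s, Fintype (Y s)] [∀ s, Nonempty (Y s)] {σ : ∀ s, X s → Y s → ℝ}
    (hσ : ∀ s q b, 0 ≤ σ s q b) (hσ1 : ∀ s q, ∑ b, σ s q b ≤ 1) (F : ∀ s, Y s → A s) :
    ∑ x, G.μ x * ∑ b : ∀ s, Y s, (∏ s, σ s (x s) (b s)) *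
      (if G.V x (fun s => F s (b s)) = true then 1 else 0) ≤ G.val := by
  classical
  -- The missing mass is put on an arbitrary point.
  have hle : ∀ s q b, σ s q b ≤ σ s q b +
      (if b = Classical.arbitrary (Y s) then 1 - ∑ b', σ s q b' else 0) := fun s q b => by
    have := hσ1 s q
    split_ifs <;> linarith
  refine le_trans ?_ (G.sum_stochastic_le_val (σ := fun s q b => σ s q b +
    if b = Classical.arbitrary (Y s) then 1 - ∑ b', σ s q b' else 0) ?_ ?_ F)
  · refine sum_le_sum fun x _ => mul_le_mul_of_nonneg_left (sum_le_sum fun b _ => ?_) (G.μ_nonneg x)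
    refine mul_le_mul_of_nonneg_right
      (prod_le_prod (fun s _ => hσ _ _ _) fun s _ => hle _ _ _) ?_
    split_ifs <;> norm_num
  · exact fun s q b => (hσ s q b).trans (hle s q b)
  · intro s q
    simp [sum_add_distrib]

/-- Suppose that, given the question tuple `x i = y` in coordinate `i`, the conditional weight of
the other questions factorizes over the players. Then the players can sample them on their own, and
answer for coordinate `i` by `F`: the average over `y` of the conditional probability of winning is
at most the value of the game. -/
theorem sum_mul_condExpAt_div_le_val [∀ t, Finite (A t)] (G : Game k X A) {ι : Type*} [Fintype ι]
    [DecidableEq ι] [DecidableEq (∀ t, X t)] {p : ι → (∀ t, X t) → ℝ} {e : (ι → ∀ t, X t) → ℝ}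
    {i : ι} {ω : ∀ s, (ι → X s) → ℝ} (hω : ∀ s h, 0 ≤ ω s h)
    (hfac : ∀ x : ι → ∀ t, X t,
      (∏ j ∈ univ.erase i, p j (x j)) * e x = ∏ s, ω s fun j => x j s)
    (F : ∀ s, (ι → X s) → A s) :
    ∑ y, G.μ y * (condExpAt p (fun x => e x *
      if G.V (x i) (fun s => F s fun j => x j s) = true then 1 else 0) i y / condExpAt p e i y) ≤
      G.val := by
  classical
  have hne := G.nonempty_question
  set M : ∀ s, X s → ℝ := fun s q => ∑ h : ι → X s, if h i = q then ω s h else 0 with hM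
  set σ : ∀ s, X s → (ι → X s) → ℝ := fun s q h => (if h i = q then ω s h else 0) / M s q with hσ
  have hM0 : ∀ s q, 0 ≤ M s q := fun s q => sum_nonneg fun h _ => by
    split_ifs
    exacts [hω s h, le_rfl]
  have hexp : ∀ (ψ : (∀ s, ι → X s) → ℝ) (y : ∀ s, X s),
      condExpAt p (fun x => e x * ψ fun s j => x j s) i y =
        ∑ h : ∀ s, ι → X s, (∏ s, if h s i = y s then ω s (h s) else 0) * ψ h := by
    intro ψ y
    rw [condExpAt, ← Equiv.sum_comp (Equiv.piComm fun (_ : ι) (s : Fin k) => X s)]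
    refine sum_congr rfl fun x _ => ?_
    by_cases hx : x i = y
    · rw [if_pos hx, ← mul_assoc, hfac]
      congr 1
      refine prod_congr rfl fun s _ => ?_
      rw [if_pos]
      · rfl
      · rw [← hx]; rfl
    · rw [if_neg hx]
      obtain ⟨s, hs⟩ := Function.ne_iff.1 hx
      rw [prod_eq_zero (mem_univ s), zero_mul]
      exact if_neg hs
  have hden : ∀ y : ∀ s, X s, condExpAt p e i y = ∏ s, M s (y s) := fun y => by
    have h1 := hexp (fun _ => 1) y
    simp only [mul_one] at h1
    rw [h1, hM, Fintype.prod_sum]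
  have hkey := G.sum_substochastic_le_val (σ := σ) (fun s q h => ?_) (fun s q => ?_) F
  · refine le_of_eq_of_le ?_ hkey
    refine sum_congr rfl fun y _ => ?_
    congr 1
    rw [hden, condExpAt_congr_right (e' := fun x => e x * (fun h : ∀ s, ι → X s =>
      if G.V y (fun s => F s (h s)) = true then (1 : ℝ) else 0) fun s j => x j s)
      fun x hx => by rw [hx],
      hexp (fun h => if G.V y (fun s => F s (h s)) = true then (1 : ℝ) else 0), sum_div]
    refine sum_congr rfl fun h _ => ?_
    simp only [hσ]
    rw [prod_div_distrib]
    ring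
  · refine div_nonneg ?_ (hM0 s q)
    split_ifs
    exacts [hω s h, le_rfl]
  · simp only [hσ]
    rw [← sum_div]
    exact div_self_le_one _

end Game

/-! ### Winning one more coordinate -/

/-- If a random weight `T` is spread almost evenly over the probability space `(Q, μ)`, then a part
`S` of it, whose proportion `S / T` has mean at most `v`, is not much more than `v` times the
whole. The spread of `T` is measured by the variance of `√T`. -/
theorem sum_mul_le_of_sum_mul_div_le {Q : Type*} [Fintype Q] {μ S T : Q → ℝ} {v β m : ℝ}
    (hμ : ∀ y, 0 ≤ μ y) (hμ1 : ∑ y, μ y = 1) (hS : ∀ y, 0 ≤ S y) (hST : ∀ y, S y ≤ T y)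
    (hv : 0 ≤ v) (hratio : ∑ y, μ y * (S y / T y) ≤ v) (hβ : 0 < β)
    (hm : m = ∑ y, μ y * √(T y)) :
    ∑ y, μ y * S y ≤
      v * ∑ y, μ y * T y + β * ∑ y, μ y * (√(T y) - m) ^ 2 + 1 / β * ∑ y, μ y * T y := by
  have hT : ∀ y, 0 ≤ T y := fun y => (hS y).trans (hST y)
  have hm0 : 0 ≤ m := hm ▸ Finset.sum_nonneg fun y _ => mul_nonneg (hμ y) (Real.sqrt_nonneg _)
  have hvar : ∑ y, μ y * (√(T y) - m) ^ 2 = ∑ y, μ y * T y - m ^ 2 := by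
    have h1 : ∀ y, μ y * (√(T y) - m) ^ 2 =
        μ y * T y - 2 * m * (μ y * √(T y)) + m ^ 2 * μ y := fun y => by
      rw [sub_sq, Real.sq_sqrt (hT y)]
      ring
    rw [Finset.sum_congr rfl fun y _ => h1 y, Finset.sum_add_distrib, Finset.sum_sub_distrib,
      ← Finset.mul_sum, ← Finset.mul_sum, hμ1, ← hm]
    ring
  have hvar0 : 0 ≤ ∑ y, μ y * (√(T y) - m) ^ 2 :=
    Finset.sum_nonneg fun y _ => mul_nonneg (hμ y) (sq_nonneg _)
  have hpt : ∀ y, S y ≤ m ^ 2 * (S y / T y) + β * (√(T y) - m) ^ 2 +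
      1 / (4 * β) * (√(T y) + m) ^ 2 := fun y => by
    have hr0 : 0 ≤ S y / T y := div_nonneg (hS y) (hT y)
    have hr1 : S y / T y ≤ 1 := div_le_one_of_le₀ (hST y) (hT y)
    have hSr : S y = √(T y) ^ 2 * (S y / T y) := by
      rw [Real.sq_sqrt (hT y)]
      rcases eq_or_ne (T y) 0 with h | h
      · have := hST y
        rw [h, zero_mul]
        linarith [hS y]
      · rw [mul_div_cancel₀ _ h]
    have hamgm : |√(T y) ^ 2 - m ^ 2| ≤
        β * (√(T y) - m) ^ 2 + 1 / (4 * β) * (√(T y) + m) ^ 2 := by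
      have h2 : ∀ σ : ℝ, σ ^ 2 = 1 → 0 ≤ β * (√(T y) - m) ^ 2 +
          1 / (4 * β) * (√(T y) + m) ^ 2 - σ * (√(T y) ^ 2 - m ^ 2) := fun σ hσ => by
        have : β * (√(T y) - m) ^ 2 + 1 / (4 * β) * (√(T y) + m) ^ 2 -
            σ * (√(T y) ^ 2 - m ^ 2) =
            1 / (4 * β) * (2 * β * (√(T y) - m) - σ * (√(T y) + m)) ^ 2 := by
          field_simp
          linear_combination (-(√(T y) + m) ^ 2) * hσ
        rw [this]
        positivity
      rw [abs_le]
      constructor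
      · linarith [h2 (-1) (by norm_num)]
      · linarith [h2 1 (by norm_num)]
    have h3 : (√(T y) ^ 2 - m ^ 2) * (S y / T y) ≤ |√(T y) ^ 2 - m ^ 2| :=
      (mul_le_mul_of_nonneg_right (le_abs_self _) hr0).trans
        (mul_le_of_le_one_right (abs_nonneg _) hr1)
    linarith
  calc ∑ y, μ y * S y
      ≤ ∑ y, μ y * (m ^ 2 * (S y / T y) + β * (√(T y) - m) ^ 2 +
          1 / (4 * β) * (√(T y) + m) ^ 2) :=
        Finset.sum_le_sum fun y _ => mul_le_mul_of_nonneg_left (hpt y) (hμ y)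
    _ = m ^ 2 * ∑ y, μ y * (S y / T y) + β * ∑ y, μ y * (√(T y) - m) ^ 2 +
          1 / (4 * β) * (∑ y, μ y * T y + 3 * m ^ 2) := by
        have h4 : ∑ y, μ y * (√(T y) + m) ^ 2 = ∑ y, μ y * T y + 3 * m ^ 2 := by
          have h1 : ∀ y, μ y * (√(T y) + m) ^ 2 =
              μ y * T y + 2 * m * (μ y * √(T y)) + m ^ 2 * μ y := fun y => by
            rw [add_sq, Real.sq_sqrt (hT y)]
            ring
          rw [Finset.sum_congr rfl fun y _ => h1 y, Finset.sum_add_distrib,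
            Finset.sum_add_distrib, ← Finset.mul_sum, ← Finset.mul_sum, hμ1, ← hm]
          ring
        rw [← h4, Finset.mul_sum, Finset.mul_sum, Finset.mul_sum, ← Finset.sum_add_distrib,
          ← Finset.sum_add_distrib]
        exact Finset.sum_congr rfl fun y _ => by ring
    _ ≤ v * ∑ y, μ y * T y + β * ∑ y, μ y * (√(T y) - m) ^ 2 + 1 / β * ∑ y, μ y * T y := by
        have h5 : m ^ 2 ≤ ∑ y, μ y * T y := by linarith
        have h6 : m ^ 2 * ∑ y, μ y * (S y / T y) ≤ v * ∑ y, μ y * T y :=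
          (mul_le_mul_of_nonneg_left hratio (sq_nonneg m)).trans
            (by rw [mul_comm]; exact mul_le_mul_of_nonneg_left h5 hv)
        have h7 : 1 / (4 * β) * (∑ y, μ y * T y + 3 * m ^ 2) ≤
            1 / (4 * β) * (4 * ∑ y, μ y * T y) :=
          mul_le_mul_of_nonneg_left (by linarith) (by positivity)
        have h8 : 1 / (4 * β) * (4 * ∑ y, μ y * T y) = 1 / β * ∑ y, μ y * T y := by
          field_simp
        linarith

namespace Game

open Finset

variable {k : ℕ} {X : Fin k → Type*} {A : Fin k → Type*} {ι : Type*}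

/-- The answers in coordinate `j` of the repeated game, when the players use the strategy `F` and
the question tuples are `x`. -/
def answers (F : ∀ t, (ι → X t) → ι → A t) (x : ι → ∀ t, X t) (j : ι) : ∀ t, A t :=
  fun t => F t (fun j' => x j' t) j

section AnswersEq

variable [∀ t, DecidableEq (A t)]

/-- The indicator of the event that the answers in the coordinates of `C` are `a`. -/
noncomputable def answersEq (F : ∀ t, (ι → X t) → ι → A t) (C : Finset ι) (a : C → ∀ t, A t)
    (x : ι → ∀ t, X t) : ℝ :=
  if (fun j : C => answers F x j) = a then 1 else 0

theorem answersEq_nonneg (F : ∀ t, (ι → X t) → ι → A t) (C : Finset ι)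
    (a : C → ∀ t, A t) (x : ι → ∀ t, X t) : 0 ≤ answersEq F C a x := by
  unfold answersEq
  split_ifs <;> norm_num

theorem answersEq_le_one (F : ∀ t, (ι → X t) → ι → A t) (C : Finset ι)
    (a : C → ∀ t, A t) (x : ι → ∀ t, X t) : answersEq F C a x ≤ 1 := by
  unfold answersEq
  split_ifs <;> norm_num

end AnswersEq

variable [∀ t, Fintype (X t)]

section Weights

variable [Fintype ι]

/-- The probability of the public question tuples `z`, if the answers `a` to them win in all the
coordinates of `C`; zero otherwise. -/
noncomputable def acceptWeight (G : Game k X A) (C : Finset ι) (z : ι → ∀ t, X t)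
    (a : C → ∀ t, A t) : ℝ :=
  (∏ j, G.μ (z j)) * if ∀ j : C, G.V (z j) (a j) = true then 1 else 0

theorem acceptWeight_nonneg (G : Game k X A) (C : Finset ι) (z : ι → ∀ t, X t)
    (a : C → ∀ t, A t) : 0 ≤ G.acceptWeight C z a :=
  mul_nonneg (prod_nonneg fun _ _ => G.μ_nonneg _) (by split_ifs <;> norm_num)

theorem sum_prod_μ [DecidableEq ι] (G : Game k X A) : ∑ z : ι → ∀ t, X t, ∏ j, G.μ (z j) = 1 := by
  rw [← Fintype.prod_sum (fun (_ : ι) (y : ∀ t, X t) => G.μ y)]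
  simp [G.μ_sum]

/-- The probability that the strategy `F` for the repeated game wins in all the coordinates
in `C`. -/
noncomputable def winOn [DecidableEq ι] (G : Game k X A) (F : ∀ t, (ι → X t) → ι → A t)
    (C : Finset ι) : ℝ :=
  ∑ x : ι → ∀ t, X t, (∏ j, G.μ (x j)) *
    if ∀ j ∈ C, G.V (x j) (answers F x j) = true then 1 else 0

end Weights

variable [DecidableEq ι] [∀ t, DecidableEq (X t)]

/-- The factor of player `s` in `G.pinnedResample C τ j z`. -/
noncomputable def pinnedFactor (G : Game k X A) (C : Finset ι) (τ : ι → Fin k) (j : ι)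
    (z : ∀ t, X t) (s : Fin k) (q : X s) : ℝ :=
  if j ∈ C then (if z s = q then 1 else 0) else G.resampleFactor (τ j) z s q

/-- The law of the question tuple `x j`, given the tuple `z j` that is made public: `x j = z j` in
the coordinates of `C`; in the others, `x j` arises from `z j` by resampling the question of player
`τ j`, so that the public information about `x j` consists of the questions of the other players. -/
noncomputable def pinnedResample (G : Game k X A) (C : Finset ι) (τ : ι → Fin k) (j : ι)
    (z x : ∀ t, X t) : ℝ :=
  ∏ s, G.pinnedFactor C τ j z s (x s)

section Pinned

variable (G : Game k X A) (C : Finset ι) (τ : ι → Fin k)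

theorem pinnedFactor_nonneg (j : ι) (z : ∀ t, X t) (s : Fin k) (q : X s) :
    0 ≤ G.pinnedFactor C τ j z s q := by
  unfold pinnedFactor
  split_ifs
  exacts [zero_le_one, le_rfl, G.resampleFactor_nonneg _ _ _ _]

theorem pinnedResample_nonneg (j : ι) (z x : ∀ t, X t) : 0 ≤ G.pinnedResample C τ j z x :=
  prod_nonneg fun _ _ => G.pinnedFactor_nonneg _ _ _ _ _ _

theorem pinnedResample_of_mem {j : ι} (hj : j ∈ C) (z x : ∀ t, X t) :
    G.pinnedResample C τ j z x = if z = x then 1 else 0 := by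
  simp only [pinnedResample, pinnedFactor, if_pos hj, Finset.prod_boole, funext_iff]
  simp

theorem pinnedResample_of_notMem {j : ι} (hj : j ∉ C) (z x : ∀ t, X t) :
    G.pinnedResample C τ j z x = G.resample (τ j) z x := by
  simp only [pinnedResample, pinnedFactor, if_neg hj, resample]

theorem sum_pinnedResample_le_one (j : ι) (z : ∀ t, X t) :
    ∑ x, G.pinnedResample C τ j z x ≤ 1 := by
  by_cases hj : j ∈ C
  · simp [G.pinnedResample_of_mem C τ hj]
  · simp_rw [G.pinnedResample_of_notMem C τ hj]
    exact G.sum_resample_le_one _ _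

theorem sum_μ_mul_pinnedResample (j : ι) (x : ∀ t, X t) :
    ∑ z, G.μ z * G.pinnedResample C τ j z x = G.μ x := by
  by_cases hj : j ∈ C
  · simp [G.pinnedResample_of_mem C τ hj]
  · simp_rw [G.pinnedResample_of_notMem C τ hj]
    exact G.sum_μ_mul_resample _ _

end Pinned

variable [Fintype ι] [∀ t, DecidableEq (A t)]

/-- The conditional probability of the answers `a` on `C`, given the public tuples `z`. -/
noncomputable def answerProb (G : Game k X A) (F : ∀ t, (ι → X t) → ι → A t) (C : Finset ι)
    (τ : ι → Fin k) (z : ι → ∀ t, X t) (a : C → ∀ t, A t) : ℝ :=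
  ∑ x : ι → ∀ t, X t, (∏ j, G.pinnedResample C τ j (z j) (x j)) * answersEq F C a x

/-- The conditional probability of the answers `a` on `C`, given the public tuples `z j` for
`j ≠ i` and all the questions `y` in coordinate `i`. -/
noncomputable def answerProbAt (G : Game k X A) (F : ∀ t, (ι → X t) → ι → A t) (C : Finset ι)
    (τ : ι → Fin k) (i : ι) (z : ι → ∀ t, X t) (a : C → ∀ t, A t) (y : ∀ t, X t) : ℝ :=
  condExpAt (fun j => G.pinnedResample C τ j (z j)) (answersEq F C a) i y

theorem answerProbAt_congr (G : Game k X A) (F : ∀ t, (ι → X t) → ι → A t) (C : Finset ι)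
    {τ τ' : ι → Fin k} {i : ι} {z z' : ι → ∀ t, X t}
    (hτ : ∀ j, j ≠ i → τ j = τ' j) (hz : ∀ j, j ≠ i → z j = z' j) (a : C → ∀ t, A t)
    (y : ∀ t, X t) : G.answerProbAt F C τ i z a y = G.answerProbAt F C τ' i z' a y := by
  refine condExpAt_congr (fun j hj => ?_) y
  funext x
  simp only [pinnedResample, pinnedFactor]
  rw [hτ j hj, hz j hj]

/-- The squared Hellinger distance between the law of `x i` given the public information and the
winning answers on `C`, and its law given the public information only, averaged over both. It is
not normalized by the probability of winning on `C`. -/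
noncomputable def hellingerAt [∀ t, Fintype (A t)] (G : Game k X A)
    (F : ∀ t, (ι → X t) → ι → A t) (C : Finset ι) (τ : ι → Fin k) (i : ι) : ℝ :=
  ∑ z : ι → ∀ t, X t, ∑ a : C → ∀ t, A t, G.acceptWeight C z a *
    ∑ y, G.pinnedResample C τ i (z i) y *
      (√(G.answerProbAt F C τ i z a y) - √(G.answerProb F C τ z a)) ^ 2

/-- The variance over the question tuple `y ~ G.μ` of the square root of
`G.answerProbAt F C τ i z a y`, summed over the winning answers and averaged over the public
information. -/
noncomputable def varianceAt [∀ t, Fintype (A t)] (G : Game k X A)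
    (F : ∀ t, (ι → X t) → ι → A t) (C : Finset ι) (τ : ι → Fin k) (i : ι) : ℝ :=
  ∑ z : ι → ∀ t, X t, ∑ a : C → ∀ t, A t, G.acceptWeight C z a *
    ∑ y, G.μ y * (√(G.answerProbAt F C τ i z a y) -
      ∑ y', G.μ y' * √(G.answerProbAt F C τ i z a y')) ^ 2

section Step

variable [∀ t, Fintype (A t)] (G : Game k X A) (F : ∀ t, (ι → X t) → ι → A t) (C : Finset ι)
  (τ : ι → Fin k)

/-- Drawing public tuples `z` from `G.μ` and then `x` by kernels `κ` that preserve `G.μ`, and that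
keep the coordinates in `C`, is the same as drawing `x` from `G.μ`. -/
theorem sum_acceptWeight_mul {κ : ι → (∀ t, X t) → (∀ t, X t) → ℝ}
    (hκ : ∀ j x, ∑ z, G.μ z * κ j z x = G.μ x)
    (hκC : ∀ j ∈ C, ∀ z x, z ≠ x → κ j z x = 0) (ψ : (ι → ∀ t, X t) → ℝ) :
    ∑ z : ι → ∀ t, X t, ∑ a : C → ∀ t, A t, G.acceptWeight C z a *
      ∑ x : ι → ∀ t, X t, (∏ j, κ j (z j) (x j)) * (answersEq F C a x * ψ x) =
    ∑ x : ι → ∀ t, X t, (∏ j, G.μ (x j)) *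
      ((if ∀ j ∈ C, G.V (x j) (answers F x j) = true then 1 else 0) * ψ x) := by
  have h1 : ∀ z x : ι → ∀ t, X t, ∑ a : C → ∀ t, A t, G.acceptWeight C z a *
      ((∏ j, κ j (z j) (x j)) * (answersEq F C a x * ψ x)) =
      (∏ j, G.μ (z j) * κ j (z j) (x j)) *
        ((if ∀ j ∈ C, G.V (x j) (answers F x j) = true then 1 else 0) * ψ x) := by
    intro z x
    rw [sum_eq_single (fun j : C => answers F x j)]
    · rw [answersEq, if_pos rfl, acceptWeight, prod_mul_distrib]
      by_cases hzx : ∀ j ∈ C, z j = x j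
      · have : (∀ j : C, G.V (z j) (answers F x j) = true) ↔
            ∀ j ∈ C, G.V (x j) (answers F x j) = true := by
          rw [Subtype.forall]
          exact forall₂_congr fun j hj => by rw [hzx j hj]
        simp only [this]
        ring
      · push Not at hzx
        obtain ⟨j, hj, hne⟩ := hzx
        rw [prod_eq_zero (f := fun j => κ j (z j) (x j)) (mem_univ j) (hκC j hj _ _ hne)]
        ring
    · intro a _ ha
      rw [answersEq, if_neg (Ne.symm ha)]
      ring
    · simp
  simp_rw [mul_sum]
  rw [sum_congr rfl fun z _ => sum_comm]
  simp_rw [h1]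
  rw [sum_comm]
  refine sum_congr rfl fun x _ => ?_
  rw [← sum_mul, ← Fintype.prod_sum (fun j z => G.μ z * κ j z (x j))]
  simp_rw [hκ]

theorem sum_acceptWeight_mul_answerProb :
    ∑ z : ι → ∀ t, X t, ∑ a : C → ∀ t, A t, G.acceptWeight C z a * G.answerProb F C τ z a =
      G.winOn F C := by
  have := G.sum_acceptWeight_mul F C (κ := G.pinnedResample C τ)
    (G.sum_μ_mul_pinnedResample C τ) (fun j hj z x hne => by
      rw [G.pinnedResample_of_mem C τ hj, if_neg hne]) fun _ => 1
  simp only [mul_one] at this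
  exact this

theorem sum_acceptWeight_mul_condExpAt {i : ι} (hi : i ∉ C) (ψ : (ι → ∀ t, X t) → ℝ) :
    ∑ z : ι → ∀ t, X t, ∑ a : C → ∀ t, A t, G.acceptWeight C z a *
      ∑ y, G.μ y * condExpAt (fun j => G.pinnedResample C τ j (z j))
        (fun x => answersEq F C a x * ψ x) i y =
    ∑ x : ι → ∀ t, X t, (∏ j, G.μ (x j)) *
      ((if ∀ j ∈ C, G.V (x j) (answers F x j) = true then 1 else 0) * ψ x) := by
  rw [← G.sum_acceptWeight_mul F C
    (κ := Function.update (G.pinnedResample C τ) i fun _ => G.μ) ?_ ?_ ψ]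
  · refine sum_congr rfl fun z _ => sum_congr rfl fun a _ => ?_
    have h := sum_mul_condExpAt (p := fun j => G.pinnedResample C τ j (z j))
      (e := fun x => answersEq F C a x * ψ x) G.μ (fun _ => 1) i
    simp only [mul_one] at h
    rw [h]
    congr 1
    refine sum_congr rfl fun x _ => ?_
    congr 1
    refine prod_congr rfl fun j _ => ?_
    by_cases hj : j = i
    · subst hj; simp
    · simp [hj]
  · intro j x
    by_cases hj : j = i
    · subst hj
      simp only [Function.update_self]
      rw [← sum_mul, G.μ_sum, one_mul]
    · simp only [Function.update_of_ne hj]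
      exact G.sum_μ_mul_pinnedResample C τ j x
  · intro j hj z x hne
    rw [Function.update_of_ne (ne_of_mem_of_not_mem hj hi), G.pinnedResample_of_mem C τ hj,
      if_neg hne]

/-- The answers in the coordinates of `C`, together with the event of winning there, carry
little information: at most `log (|A| ^ |C| / Pr[win on C])` in total. -/
theorem sum_hellingerAt_le [∀ t, Nonempty (A t)] (hw : 0 < G.winOn F C) :
    ∑ i, G.hellingerAt F C τ i ≤ G.winOn F C *
      Real.log ((Fintype.card (∀ t, A t) : ℝ) ^ C.card / G.winOn F C) := by
  have hN : ∀ (z : ι → ∀ t, X t) (a : C → ∀ t, A t), 0 ≤ G.answerProb F C τ z a := fun z a =>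
    sum_nonneg fun x _ => mul_nonneg
      (prod_nonneg fun j _ => G.pinnedResample_nonneg C τ _ _ _) (answersEq_nonneg F C a x)
  calc ∑ i, G.hellingerAt F C τ i
      = ∑ z : ι → ∀ t, X t, ∑ a : C → ∀ t, A t, G.acceptWeight C z a *
          ∑ i, ∑ y, G.pinnedResample C τ i (z i) y *
            (√(G.answerProbAt F C τ i z a y) - √(G.answerProb F C τ z a)) ^ 2 := by
        simp_rw [hellingerAt, mul_sum (univ : Finset ι)]
        rw [sum_comm]
        exact sum_congr rfl fun z _ => sum_comm
    _ ≤ ∑ z : ι → ∀ t, X t, ∑ a : C → ∀ t, A t, G.acceptWeight C z a *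
          Real.negMulLog (G.answerProb F C τ z a) := by
        refine sum_le_sum fun z _ => sum_le_sum fun a _ => mul_le_mul_of_nonneg_left ?_
          (G.acceptWeight_nonneg C z a)
        exact sum_sq_sqrt_condExpAt_sub_le (fun j => G.pinnedResample_nonneg C τ j _)
          (fun j => G.sum_pinnedResample_le_one C τ j _) (answersEq_nonneg F C a)
          (answersEq_le_one F C a) rfl
    _ ≤ G.winOn F C * Real.log ((Fintype.card (∀ t, A t) : ℝ) ^ C.card / G.winOn F C) := by
        have hcard : (0 : ℝ) < Fintype.card (∀ t, A t) := Nat.cast_pos.2 Fintype.card_pos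
        rw [← Fintype.sum_prod_type' (f := fun z a => G.acceptWeight C z a *
          Real.negMulLog (G.answerProb F C τ z a))]
        refine sum_mul_negMulLog_le univ (fun p _ => G.acceptWeight_nonneg C p.1 p.2)
          (fun p _ => hN p.1 p.2) ?_ hw ?_ (pow_pos hcard _)
        · rw [Fintype.sum_prod_type' (f := fun z a => G.acceptWeight C z a *
            G.answerProb F C τ z a)]
          exact G.sum_acceptWeight_mul_answerProb F C τ
        · rw [Fintype.sum_prod_type' (f := fun z a => G.acceptWeight C z a)]
          calc ∑ z : ι → ∀ t, X t, ∑ a : C → ∀ t, A t, G.acceptWeight C z a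
              ≤ ∑ z : ι → ∀ t, X t, ∑ a : C → ∀ t, A t, ∏ j, G.μ (z j) :=
                sum_le_sum fun z _ => sum_le_sum fun a _ => mul_le_of_le_one_right
                  (prod_nonneg fun _ _ => G.μ_nonneg _) (by split_ifs <;> norm_num)
            _ = (Fintype.card (∀ t, A t) : ℝ) ^ C.card := by
                simp_rw [sum_const, card_univ, nsmul_eq_mul]
                rw [← mul_sum, G.sum_prod_μ, mul_one, Fintype.card_fun, Fintype.card_coe]
                push_cast
                rfl

/-- The expansion of the connection graph: if, for a random player, the law of the public
information hardly depends on the question of this player in coordinate `i`, then it hardly depends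
on the question tuple in coordinate `i` at all. -/
theorem mul_sum_varianceAt_le (hk : k ≠ 0) {l : ℝ} (hl : 0 < l)
    (hG : G.connectionGraph.IsExpander l) {i : ι} (hi : i ∉ C) :
    l * ∑ τ, G.varianceAt F C τ i ≤ ∑ τ, G.hellingerAt F C τ i := by
  have hacc : ∀ (z : ι → ∀ t, X t) (y : ∀ t, X t) (a : C → ∀ t, A t),
      (∀ j : C, G.V (Function.update z i y j) (a j) = true) ↔
        ∀ j : C, G.V (z j) (a j) = true := fun z y a =>
    forall_congr' fun j => by rw [Function.update_of_ne (ne_of_mem_of_not_mem j.2 hi)]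
  -- Drawing the public tuple `z i` last.
  have hD : ∀ τ t, G.hellingerAt F C (Function.update τ i t) i =
      ∑ z : ι → ∀ t, X t, ∑ a : C → ∀ t, A t, G.acceptWeight C z a *
        ∑ y, G.μ y * ∑ y', G.resample t y y' * (√(G.answerProbAt F C τ i z a y') -
          √(G.answerProb F C (Function.update τ i t) (Function.update z i y) a)) ^ 2 := by
    intro τ t
    rw [hellingerAt, sum_comm, sum_comm (s := (univ : Finset (ι → ∀ t, X t)))]
    refine sum_congr rfl fun a _ => ?_
    have h := sum_prod_mul_sum_update G.μ i fun z : ι → ∀ t, X t =>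
      (if ∀ j : C, G.V (z j) (a j) = true then 1 else 0) *
        ∑ y', G.resample t (z i) y' * (√(G.answerProbAt F C τ i z a y') -
          √(G.answerProb F C (Function.update τ i t) z a)) ^ 2
    rw [G.μ_sum, one_mul] at h
    simp only [acceptWeight, mul_assoc]
    refine Eq.trans ?_ (h.symm.trans ?_)
    · refine sum_congr rfl fun z _ => ?_
      congr 2
      refine sum_congr rfl fun y' _ => ?_
      rw [G.pinnedResample_of_notMem C _ hi, Function.update_self,
        G.answerProbAt_congr F C (τ' := τ) (z' := z)
          (fun j hj => Function.update_of_ne hj _ _) fun j _ => rfl]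
    · refine sum_congr rfl fun z _ => ?_
      congr 1
      rw [mul_sum]
      refine sum_congr rfl fun y _ => ?_
      simp only [hacc, Function.update_self]
      rw [mul_left_comm]
      congr 2
      refine sum_congr rfl fun y' _ => ?_
      rw [G.answerProbAt_congr F C (τ := τ) (τ' := τ) (z' := z) (fun j _ => rfl)
          (z := Function.update z i y) fun j hj => Function.update_of_ne hj _ _]
  have hτ : ∀ τ, l * (k * G.varianceAt F C τ i) ≤
      ∑ t, G.hellingerAt F C (Function.update τ i t) i := by
    intro τ
    simp_rw [hD]
    rw [sum_comm, varianceAt, mul_sum, mul_sum]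
    refine sum_le_sum fun z _ => ?_
    rw [sum_comm, mul_sum, mul_sum]
    refine sum_le_sum fun a _ => ?_
    rw [← mul_sum]
    have h := G.mul_variance_le_sum_resample hk hl hG
      (fun y => √(G.answerProbAt F C τ i z a y)) fun t y =>
        √(G.answerProb F C (Function.update τ i t) (Function.update z i y) a)
    have := mul_le_mul_of_nonneg_left h (G.acceptWeight_nonneg C z a)
    linarith
  have hsum := sum_prod_mul_sum_update (fun _ : Fin k => (1 : ℝ)) i
    fun τ => G.hellingerAt F C τ i
  simp only [prod_const_one, one_mul, sum_const, card_univ, Fintype.card_fin, nsmul_eq_mul,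
    mul_one] at hsum
  have hk' : (0 : ℝ) < k := Nat.cast_pos.2 (Nat.pos_of_ne_zero hk)
  refine le_of_mul_le_mul_left ?_ hk'
  rw [← hsum, mul_left_comm, mul_sum, mul_sum]
  exact sum_le_sum fun τ _ => hτ τ

/-- Given the public information, the players can simulate the repeated game in order to play `G`:
they insert their questions into coordinate `i`, and sample all the others on their own. -/
theorem winOn_insert_le {i : ι} (hi : i ∉ C) {β : ℝ} (hβ : 0 < β) :
    G.winOn F (insert i C) ≤
      G.val * G.winOn F C + β * G.varianceAt F C τ i + 1 / β * G.winOn F C := by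
  set ψ : (ι → ∀ t, X t) → ℝ := fun x => if G.V (x i) (answers F x i) = true then 1 else 0 with hψ
  have hψ0 : ∀ x, 0 ≤ ψ x := fun x => by simp only [hψ]; split_ifs <;> norm_num
  have hψ1 : ∀ x, ψ x ≤ 1 := fun x => by simp only [hψ]; split_ifs <;> norm_num
  have hA : ∀ s, ∀ x : ι → ∀ t, X t, Nonempty (A s) := fun s x => ⟨answers F x i s⟩
  have hval : 0 ≤ G.val := by
    have hne := G.nonempty_question
    have x : ι → ∀ t, X t := Classical.arbitrary _
    refine le_trans ?_ (G.winProb_le_val fun t _ => answers F x i t)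
    exact sum_nonneg fun y _ => by split_ifs; exacts [G.μ_nonneg y, le_rfl]
  have hleft : G.winOn F (insert i C) =
      ∑ z : ι → ∀ t, X t, ∑ a : C → ∀ t, A t, G.acceptWeight C z a *
        ∑ y, G.μ y * condExpAt (fun j => G.pinnedResample C τ j (z j))
          (fun x => answersEq F C a x * ψ x) i y := by
    rw [G.sum_acceptWeight_mul_condExpAt F C τ hi ψ, winOn]
    refine sum_congr rfl fun x _ => ?_
    congr 1
    simp only [hψ, forall_mem_insert, ite_and]
    split_ifs <;> simp
  have hright : G.winOn F C =
      ∑ z : ι → ∀ t, X t, ∑ a : C → ∀ t, A t, G.acceptWeight C z a *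
        ∑ y, G.μ y * G.answerProbAt F C τ i z a y := by
    have := G.sum_acceptWeight_mul_condExpAt F C τ hi fun _ => 1
    simp only [mul_one] at this
    rw [winOn, ← this]
    rfl
  rw [hleft, hright, varianceAt]
  simp_rw [mul_sum (univ : Finset (ι → ∀ t, X t)), mul_sum (univ : Finset (C → ∀ t, A t)),
    ← sum_add_distrib]
  refine sum_le_sum fun z _ => sum_le_sum fun a _ => ?_
  have hpos : ∀ j y, 0 ≤ G.pinnedResample C τ j (z j) y := fun j =>
    G.pinnedResample_nonneg C τ j _
  have hle : ∀ y, condExpAt (fun j => G.pinnedResample C τ j (z j))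
      (fun x => answersEq F C a x * ψ x) i y ≤ G.answerProbAt F C τ i z a y := fun y => by
    refine sum_le_sum fun x _ => ?_
    split_ifs
    · exact mul_le_mul_of_nonneg_left (mul_le_of_le_one_right (answersEq_nonneg F C a x) (hψ1 x))
        (prod_nonneg fun j _ => hpos j _)
    · exact le_rfl
  have h := sum_mul_le_of_sum_mul_div_le (S := fun y =>
      condExpAt (fun j => G.pinnedResample C τ j (z j)) (fun x => answersEq F C a x * ψ x) i y)
    (T := G.answerProbAt F C τ i z a) G.μ_nonneg G.μ_sum
    (fun y => condExpAt_nonneg hpos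
      (fun x => mul_nonneg (answersEq_nonneg F C a x) (hψ0 x)) i y) hle hval ?_ hβ rfl
  · have := mul_le_mul_of_nonneg_left h (G.acceptWeight_nonneg C z a)
    linarith
  · refine G.sum_mul_condExpAt_div_le_val (ω := fun s h =>
      (∏ j ∈ univ.erase i, G.pinnedFactor C τ j (z j) s (h j)) *
        if (fun j : C => F s h j) = fun j => a j s then 1 else 0) (fun s h => ?_) (fun x => ?_)
      fun s h => F s h i
    · exact mul_nonneg (prod_nonneg fun j _ => G.pinnedFactor_nonneg _ _ _ _ _ _)
        (by split_ifs <;> norm_num)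
    · simp only [pinnedResample]
      rw [prod_comm, prod_mul_distrib]
      congr 1
      rw [Finset.prod_boole, answersEq]
      congr 1
      simp only [mem_univ, true_imp_iff, funext_iff, answers, eq_iff_iff]
      exact forall_comm

/-- As long as winning on `C` is not too unlikely compared with the number of possible answers
there, some further coordinate is lost with a conditional probability of order `ε`. -/
theorem exists_winOn_insert_le (hk : k ≠ 0) {ε l : ℝ} (hε : 0 < ε) (hl : 0 < l)
    (hG : G.connectionGraph.IsExpander l) (hval : G.val ≤ 1 - ε) [∀ t, Nonempty (A t)]
    (hC : C.card < Fintype.card ι) (hw : 0 < G.winOn F C)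
    (hlog : Real.log ((Fintype.card (∀ t, A t) : ℝ) ^ C.card / G.winOn F C) ≤
      ε ^ 2 * l / 16 * (Fintype.card ι - C.card)) :
    ∃ i, i ∉ C ∧ G.winOn F (insert i C) ≤ (1 - ε / 2) * G.winOn F C := by
  have : Nonempty (Fin k) := ⟨⟨0, Nat.pos_of_ne_zero hk⟩⟩
  obtain ⟨i, hi, τ, hτ⟩ : ∃ i, i ∉ C ∧ ∃ τ, G.varianceAt F C τ i ≤ ε ^ 2 / 16 * G.winOn F C := by
    by_contra! hcon
    have h1 : ∑ i ∈ Cᶜ, ∑ _τ : ι → Fin k, ε ^ 2 / 16 * G.winOn F C <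
        ∑ i ∈ Cᶜ, ∑ τ, G.varianceAt F C τ i := by
      refine sum_lt_sum_of_nonempty ?_ fun i hi => ?_
      · rw [← card_pos, card_compl]
        omega
      · exact sum_lt_sum_of_nonempty univ_nonempty fun τ _ => hcon i (mem_compl.1 hi) τ
    have hH0 : ∀ τ i, 0 ≤ G.hellingerAt F C τ i := fun τ i => sum_nonneg fun z _ =>
      sum_nonneg fun a _ => mul_nonneg (G.acceptWeight_nonneg C z a) (sum_nonneg fun y _ =>
        mul_nonneg (G.pinnedResample_nonneg C τ _ _ _) (sq_nonneg _))
    have h2 : l * ∑ i ∈ Cᶜ, ∑ τ, G.varianceAt F C τ i ≤ ∑ _τ : ι → Fin k, G.winOn F C *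
        (ε ^ 2 * l / 16 * (Fintype.card ι - C.card)) := by
      calc l * ∑ i ∈ Cᶜ, ∑ τ, G.varianceAt F C τ i
          ≤ ∑ i ∈ Cᶜ, ∑ τ, G.hellingerAt F C τ i := by
            rw [mul_sum]
            exact sum_le_sum fun i hi =>
              G.mul_sum_varianceAt_le F C hk hl hG (mem_compl.1 hi)
        _ ≤ ∑ i, ∑ τ, G.hellingerAt F C τ i :=
            sum_le_sum_of_subset_of_nonneg (subset_univ _) fun i _ _ =>
              sum_nonneg fun τ _ => hH0 τ i
        _ = ∑ τ, ∑ i, G.hellingerAt F C τ i := sum_comm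
        _ ≤ _ := sum_le_sum fun τ _ => (G.sum_hellingerAt_le F C τ hw).trans
            (mul_le_mul_of_nonneg_left hlog hw.le)
    have h3 := mul_lt_mul_of_pos_left h1 hl
    simp only [sum_const, nsmul_eq_mul, card_compl, card_univ] at h2 h3
    rw [Nat.cast_sub hC.le] at h3
    linarith
  refine ⟨i, hi, (G.winOn_insert_le F C τ hi (β := 4 / ε) (by positivity)).trans ?_⟩
  have h4 : G.val * G.winOn F C ≤ (1 - ε) * G.winOn F C :=
    mul_le_mul_of_nonneg_right hval hw.le
  have h5 : 4 / ε * G.varianceAt F C τ i ≤ 4 / ε * (ε ^ 2 / 16 * G.winOn F C) :=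
    mul_le_mul_of_nonneg_left hτ (by positivity)
  have h6 : 4 / ε * (ε ^ 2 / 16 * G.winOn F C) = ε / 4 * G.winOn F C := by
    field_simp
    norm_num
  have h7 : 1 / (4 / ε) = ε / 4 := one_div_div _ _
  rw [h7]
  linarith

end Step

end Game

/-! ### Iteration -/

namespace Game

open Finset

variable {k : ℕ} {X : Fin k → Type*} {A : Fin k → Type*} [∀ t, Fintype (X t)]

theorem winOn_anti {ι : Type*} [Fintype ι] [DecidableEq ι] (G : Game k X A)
    (F : ∀ t, (ι → X t) → ι → A t) {C D : Finset ι} (h : C ⊆ D) :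
    G.winOn F D ≤ G.winOn F C := by
  refine sum_le_sum fun x _ => mul_le_mul_of_nonneg_left ?_
    (prod_nonneg fun _ _ => G.μ_nonneg _)
  split_ifs with h1 h2
  · exact le_rfl
  · exact absurd (fun j hj => h1 j (h hj)) h2
  · exact zero_le_one
  · exact le_rfl

theorem winProb_parallel (G : Game k X A) (n : ℕ) (F : ∀ t, (Fin n → X t) → Fin n → A t) :
    (G.parallel n).winProb F = G.winOn F univ := by
  rw [winOn, ← Equiv.sum_comp (Equiv.piComm fun (t : Fin k) (_ : Fin n) => X t), winProb]
  refine sum_congr rfl fun x _ => ?_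
  simp only [parallel, decide_eq_true_eq, mem_univ, true_imp_iff, mul_ite, mul_one, mul_zero]
  rfl

theorem winOn_empty {ι : Type*} [Fintype ι] [DecidableEq ι] (G : Game k X A)
    (F : ∀ t, (ι → X t) → ι → A t) : G.winOn F ∅ = 1 := by
  simp [winOn, G.sum_prod_μ]

/-- Winning `s` suitably chosen coordinates has probability at most `exp (-(ε / 2) * s)`, as long
as `s * log |A|` is small compared with `ε ^ 2 * l` times the number of coordinates. -/
theorem winOn_univ_le_exp [∀ t, Fintype (A t)] [∀ t, Nonempty (A t)] (G : Game k X A) (hk : k ≠ 0)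
    {ι : Type*} [Fintype ι] [DecidableEq ι] (F : ∀ t, (ι → X t) → ι → A t) {ε l : ℝ} (hε : 0 < ε)
    (hl : 0 < l) (hG : G.connectionGraph.IsExpander l) (hval : G.val ≤ 1 - ε) {s : ℕ}
    (hs : s * Real.log (Fintype.card (∀ t, A t)) + ε / 2 * s ≤
      ε ^ 2 * l / 16 * (Fintype.card ι - s)) (hsι : s ≤ Fintype.card ι) :
    G.winOn F univ ≤ Real.exp (-(ε / 2 * s)) := by
  classical
  by_contra! hcon
  -- Now winning on any `C` is so likely that the induction never gets stuck.
  have hlarge : ∀ C, Real.exp (-(ε / 2 * s)) < G.winOn F C := fun C =>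
    hcon.trans_le (G.winOn_anti F (subset_univ C))
  have hcardA : (0 : ℝ) < Fintype.card (∀ t, A t) := Nat.cast_pos.2 Fintype.card_pos
  have hL : 0 ≤ Real.log (Fintype.card (∀ t, A t)) := Real.log_natCast_nonneg _
  have key : ∀ j : ℕ, j ≤ s → ∃ C : Finset ι, C.card = j ∧
      G.winOn F C ≤ Real.exp (-(ε / 2 * j)) := by
    intro j
    induction j with
    | zero => exact fun _ => ⟨∅, rfl, by simp [winOn_empty]⟩
    | succ j ih =>
      intro hj
      obtain ⟨C, hC, hCw⟩ := ih (by omega)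
      have hw : 0 < G.winOn F C := (Real.exp_pos _).trans (hlarge C)
      have hjs : (j : ℝ) ≤ s := Nat.cast_le.2 (by omega)
      obtain ⟨i, hi, hiw⟩ := G.exists_winOn_insert_le F C hk hε hl hG hval (by omega) hw (by
        rw [Real.log_div (pow_pos hcardA _).ne' hw.ne', Real.log_pow, hC]
        have h1 : -(ε / 2 * s) ≤ Real.log (G.winOn F C) := by
          rw [Real.le_log_iff_exp_le hw]
          exact (hlarge C).le
        have h2 := mul_le_mul_of_nonneg_right hjs hL
        have h3 : ε ^ 2 * l / 16 * (Fintype.card ι - s) ≤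
            ε ^ 2 * l / 16 * (Fintype.card ι - j) :=
          mul_le_mul_of_nonneg_left (by linarith) (by positivity)
        linarith)
      refine ⟨insert i C, by rw [card_insert_of_notMem hi, hC], hiw.trans ?_⟩
      have h4 : 1 - ε / 2 ≤ Real.exp (-(ε / 2)) := by
        linarith [Real.add_one_le_exp (-(ε / 2))]
      calc (1 - ε / 2) * G.winOn F C ≤ Real.exp (-(ε / 2)) * Real.exp (-(ε / 2 * j)) :=
            mul_le_mul h4 hCw hw.le (Real.exp_pos _).le
        _ = Real.exp (-(ε / 2 * (j + 1 : ℕ))) := by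
            rw [← Real.exp_add]
            push_cast
            ring_nf
  obtain ⟨C, -, hC⟩ := key s le_rfl
  exact (hlarge C).not_ge hC

/-- The bound of the parallel repetition theorem, with a better dependence on `ε` and `l`. -/
theorem winOn_univ_le [∀ t, Fintype (A t)] (G : Game k X A) {n : ℕ} (hn : 0 < n)
    (F : ∀ t, (Fin n → X t) → Fin n → A t) {ε l : ℝ} (hε : 0 < ε) (hε1 : ε < 1) (hl : 0 < l)
    (hl1 : l < 1) (hA : 2 ≤ Fintype.card (∀ t, A t)) (hG : G.connectionGraph.IsExpander l)
    (hval : G.val ≤ 1 - ε) :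
    G.winOn F univ ≤
      Real.exp (-(ε ^ 3 * l * n / (256 * Real.log (Fintype.card (∀ t, A t))))) := by
  classical
  have hk : k ≠ 0 := by
    rintro rfl
    simp at hA
  have hne : ∀ t, Nonempty (A t) := fun t => by
    obtain ⟨a⟩ : Nonempty (∀ t, A t) := Fintype.card_pos_iff.1 (by omega)
    exact ⟨a t⟩
  set L := Real.log (Fintype.card (∀ t, A t)) with hLdef
  have hL : 1 / 2 < L := by
    have h1 : Real.log 2 ≤ L := Real.log_le_log (by norm_num) (by exact_mod_cast hA)
    linarith [Real.log_two_gt_d9]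
  have hn' : (1 : ℝ) ≤ n := by exact_mod_cast hn
  set x := ε ^ 2 * l * n / (64 * L) with hx
  have hxL : x * L = ε ^ 2 * l * n / 64 := by
    rw [hx]
    field_simp
  have hx0 : 0 ≤ x := by positivity
  have hgoal : ε ^ 3 * l * n / (256 * L) = ε * x / 4 := by
    rw [hx]
    field_simp
    norm_num
  rw [hgoal]
  rcases Nat.eq_zero_or_pos ⌊x⌋₊ with h0 | hpos
  · have hx1 : x < 1 := Nat.floor_eq_zero.1 h0
    obtain ⟨i, -, hi⟩ := G.exists_winOn_insert_le F ∅ hk hε hl hG hval (by simpa using hn)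
      (by rw [winOn_empty]; norm_num) (by
        rw [winOn_empty]
        simp only [card_empty, pow_zero, div_one, Real.log_one, Nat.cast_zero, sub_zero]
        positivity)
    rw [winOn_empty, mul_one] at hi
    calc G.winOn F univ ≤ 1 - ε / 2 := (G.winOn_anti F (subset_univ _)).trans hi
      _ ≤ Real.exp (-(ε / 2)) := by linarith [Real.add_one_le_exp (-(ε / 2))]
      _ ≤ Real.exp (-(ε * x / 4)) := Real.exp_le_exp.2 (by nlinarith)
  · have hsx : (⌊x⌋₊ : ℝ) ≤ x := Nat.floor_le hx0
    have hxs : x < ⌊x⌋₊ + 1 := Nat.lt_floor_add_one x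
    have hs1 : (1 : ℝ) ≤ ⌊x⌋₊ := by exact_mod_cast hpos
    have hel : ε ^ 2 * l ≤ 1 := mul_le_one₀ (pow_le_one₀ hε.le hε1.le) hl.le hl1.le
    have hsL : ⌊x⌋₊ * L ≤ ε ^ 2 * l * n / 64 := hxL ▸ mul_le_mul_of_nonneg_right hsx (by linarith)
    have hsn : (⌊x⌋₊ : ℝ) ≤ n / 2 := by nlinarith
    refine (G.winOn_univ_le_exp hk F hε hl hG hval (s := ⌊x⌋₊) ?_ ?_).trans
      (Real.exp_le_exp.2 (by nlinarith))
    · rw [Fintype.card_fin]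
      have h1 : ε / 2 * (⌊x⌋₊ : ℝ) ≤ ⌊x⌋₊ * L := by nlinarith
      have h2 : ε ^ 2 * l / 16 * (n / 2) ≤ ε ^ 2 * l / 16 * (n - ⌊x⌋₊) :=
        mul_le_mul_of_nonneg_left (by linarith) (by positivity)
      linarith
    · rw [Fintype.card_fin]
      have : (⌊x⌋₊ : ℝ) ≤ n := by linarith
      exact_mod_cast this

end Game

theorem theorem1 :
    ∃ c : ℝ, 0 < c ∧
      ∀ (k : ℕ) (X : Fin k → Type*) (A : Fin k → Type*) [∀ t, Fintype (X t)] [∀ t, Fintype (A t)]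
        (G : Game k X A) (ε l : ℝ),
        0 < ε → ε < 1 → 0 < l → l < 1 →
        2 ≤ Fintype.card (∀ t, A t) →
        G.val ≤ 1 - ε →
        G.connectionGraph.IsExpander l →
        ∀ n : ℕ, Real.log (4 / ε) / (ε ^ 5 * l ^ 2) ≤ (n : ℝ) →
          (G.parallel n).val ≤
            Real.exp (-(c * ε ^ 5 * l ^ 2 * n / Real.log (Fintype.card (∀ t, A t)))) := by
  refine ⟨1 / 256, by norm_num, ?_⟩
  intro k X A _ _ G ε l hε hε1 hl hl1 hA hval hG n hn
  have hn0 : 0 < n := by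
    have h4 : 0 < Real.log (4 / ε) := Real.log_pos (by rw [lt_div_iff₀ hε]; linarith)
    have : (0 : ℝ) < n := lt_of_lt_of_le (by positivity) hn
    exact_mod_cast this
  have hL : 0 < Real.log (Fintype.card (∀ t, A t)) := Real.log_pos (by exact_mod_cast hA)
  have hne : Nonempty (∀ t, (Fin n → X t) → Fin n → A t) := by
    obtain ⟨a⟩ : Nonempty (∀ t, A t) := Fintype.card_pos_iff.1 (by omega)
    exact ⟨fun t _ _ => a t⟩
  refine ciSup_le fun F => ?_
  change (G.parallel n).winProb F ≤ _
  rw [G.winProb_parallel]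
  refine (G.winOn_univ_le hn0 F hε hε1 hl hl1 hA hG hval).trans (Real.exp_le_exp.2 ?_)
  rw [neg_le_neg_iff]
  have h1 : ε ^ 5 * l ^ 2 ≤ ε ^ 3 * l := by
    have : ε ^ 2 * l ≤ 1 := mul_le_one₀ (pow_le_one₀ hε.le hε1.le) hl.le hl1.le
    calc ε ^ 5 * l ^ 2 = ε ^ 3 * l * (ε ^ 2 * l) := by ring
      _ ≤ ε ^ 3 * l := mul_le_of_le_one_right (by positivity) this
  calc 1 / 256 * ε ^ 5 * l ^ 2 * n / Real.log (Fintype.card (∀ t, A t))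
      = ε ^ 5 * l ^ 2 * n / (256 * Real.log (Fintype.card (∀ t, A t))) := by
        field_simp
    _ ≤ ε ^ 3 * l * n / (256 * Real.log (Fintype.card (∀ t, A t))) := by
        gcongr
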